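/- Let $V\subset\mathbb R^n$ be a finite set of nodes and $\mathbb G=(V,E)$ a connected undirected graph whose edges are the line segments joining their end-points (different edges meet at most in a common end-point), with positive edge lengths $(w_e)_{e\in E}$. Regard $\mathbb G$ as the set of all nodes and all points of edges, with the Euclidean topology; the part of an edge $e$ between two of its points has length $w_e$ times the fraction of $e$ that it covers. Fix a root $z_0\in V$ such that for every point $x\in\mathbb G$ the shortest path $[z_0,x]$ in $\mathbb G$ is unique, and put $\Lambda(x)=\{y\in\mathbb G: x\in[z_0,y]\}$. Let $\lambda$ be the length measure on $\mathbb G$, i.e. the sum over $e\in E$ of the measure on $e$ that gives each subsegment its length, and let $\hat w(x)=1+\lambda(\Lambda(x))$. For $1\le p\le\infty$ with conjugate exponent $p'$ ($1/p+1/p'=1$), let $\mathcal B(p',\hat w)$ be the set of continuous $f:\mathbb G\to\mathbb R$ with $f(z_0)=0$ for which there is $f'\in L^{p'}(\mathbb G,\lambda)$ with $f(x)-f(z_0)=\int_{[z_0,x]}f'\,d\lambda$ for all $x\in\mathbb G$ and $\|f'\|_{L^{p'}(\mathbb G,\hat w\lambda)}\le 1$. For probability measures $\mu,\nu$ on $\mathbb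 G$ the regularized Sobolev IPM is $$\hat{\mathcal S}_p(\mu,\nu)=\sup_{f\in\mathcal B(p',\hat w)}\Big|\int_{\mathbb G} f\,d\mu-\int_{\mathbb G} f\,d\nu\Big|.$$ Let $1\le p\le 2$ and let $\Omega$ be the set of Borel probability measures on $\mathbb G$ that are supported on $V$. Then $\hat{\mathcal S}_p$ is finite on $\Omega\times\Omega$, and $\hat{\mathcal S}_p$ and $\hat{\mathcal S}_p^{\,p}$ are negative definite kernels on $\Omega$: they are symmetric, and $\sum_{i,j=1}^m c_ic_j\,k(\mu_i,\mu_j)\le 0$ for all $m$, all $\mu_1,\dots,\mu_m\in\Omega$ and all $c_1,\dots,c_m\in\mathbb R$ with $\sum_i c_i=0$, where $k$ is either kernel. Consequently, for every $t>0$, the kernels $\exp(-t\hat{\mathcal S}_p)$ and $\exp(-t\hat{\mathcal S}_p^{\,p})$ are positive definite on $\Omega$: they are symmetric, and $\sum_{i,j=1}^m c_ic_j\,k(\mu_i,\mu_j)\ge 0$ for all $m$, all $\mu_1,\dots,\mu_m\in\Omega$ and all $c_1,\dots,c_m\in\mathbb R$. -/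

import Mathlib

open MeasureTheory
open scoped ENNReal

noncomputable section

/-- A finite, connected, undirected, physical graph: its nodes are points of `ℝⁿ`, each edge `{u, v}`
is the line segment from `u` to `v` and carries a positive length `weight s(u, v)`, which need not be
the Euclidean one. Different edges meet at most in a common endpoint. -/
structure PhysicalGraph (n : ℕ) where
  nodes : Finset (EuclideanSpace ℝ (Fin n))
  graph : SimpleGraph nodes
  connected : graph.Connected
  weight : Sym2 nodes → ℝ
  weight_pos : ∀ e ∈ graph.edgeSet, 0 < weight e
  noncrossing : ∀ u v u' v' : nodes, graph.Adj u v → graph.Adj u' v' → s(u, v) ≠ s(u', v') →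
    segment ℝ (u : EuclideanSpace ℝ (Fin n)) v ∩ segment ℝ (u' : EuclideanSpace ℝ (Fin n)) v' ⊆
      ({(u : EuclideanSpace ℝ (Fin n)), ↑v} : Set (EuclideanSpace ℝ (Fin n))) ∩ {↑u', ↑v'}

namespace PhysicalGraph

variable {n : ℕ} (G : PhysicalGraph n)

/-- The continuous graph as a subset of `ℝⁿ`: all nodes and all points of the edges. -/
def carrier : Set (EuclideanSpace ℝ (Fin n)) :=
  (G.nodes : Set (EuclideanSpace ℝ (Fin n))) ∪
    ⋃ (u : G.nodes) (v : G.nodes) (_ : G.graph.Adj u v),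
      segment ℝ (u : EuclideanSpace ℝ (Fin n)) v

/-- The continuous graph as a space, with the Euclidean topology and its Borel sets. -/
abbrev Space : Type := ↥G.carrier

/-- A node, as a point of the continuous graph. -/
def node (v : G.nodes) : G.Space := ⟨v, Or.inl v.2⟩

/-- The (polygonal) paths of the continuous graph: finite concatenations of segments, each of which
runs inside one edge. -/
inductive GPath : G.Space → G.Space → Type
  | nil (x : G.Space) : GPath x x
  | cons {x y z : G.Space} (u v : G.nodes) (h : G.graph.Adj u v)
      (hx : (x : EuclideanSpace ℝ (Fin n)) ∈ segment ℝ (u : EuclideanSpace ℝ (Fin n)) v)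
      (hy : (y : EuclideanSpace ℝ (Fin n)) ∈ segment ℝ (u : EuclideanSpace ℝ (Fin n)) v)
      (rest : GPath y z) : GPath x z

/-- The length of a path: the piece from `x` to `y` of an edge of length `w` has length `w` times
the fraction of the edge that it covers. -/
def GPath.length {G : PhysicalGraph n} : {x z : G.Space} → G.GPath x z → ℝ
  | _, _, .nil _ => 0
  | _, _, .cons (x := x) (y := y) u v _ _ _ rest =>
      G.weight s(u, v) *
        (dist (x : EuclideanSpace ℝ (Fin n)) y / dist (u : EuclideanSpace ℝ (Fin n)) v) +
      rest.length

/-- The set of points that a path runs through. -/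
def GPath.trace {G : PhysicalGraph n} : {x z : G.Space} → G.GPath x z → Set G.Space
  | _, _, .nil x => {x}
  | _, _, .cons (x := x) (y := y) _ _ _ _ _ rest =>
      {q : G.Space | (q : EuclideanSpace ℝ (Fin n)) ∈
        segment ℝ (x : EuclideanSpace ℝ (Fin n)) y} ∪ rest.trace

/-- `P` is (the point set of) a shortest path between `x` and `z`. -/
def IsShortestPath (x z : G.Space) (P : Set G.Space) : Prop :=
  ∃ γ : G.GPath x z, (∀ γ' : G.GPath x z, γ.length ≤ γ'.length) ∧ γ.trace = P

/-- The uniqueness property of the shortest paths: between the root `z₀` and any point `x` of the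
continuous graph there is exactly one shortest path. -/
def UniqueShortestPaths (z₀ : G.nodes) : Prop :=
  ∀ x : G.Space, ∃! P : Set G.Space, G.IsShortestPath (G.node z₀) x P

/-- `[x, z]`: the points of the shortest path between `x` and `z` (used where it is unique). -/
def geod (x z : G.Space) : Set G.Space := {q | ∃ P, G.IsShortestPath x z P ∧ q ∈ P}

/-- `Λ(x) = {y : x ∈ [z₀, y]}`. -/
def Lam (z₀ : G.nodes) (x : G.Space) : Set G.Space := {y | x ∈ G.geod (G.node z₀) y}

/-- The length measure: the sum over the edges of the image of `w_e` times Lebesgue measure on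
`[0, 1]` under the affine parametrization of the edge (the choice of orientation that `Quot.out`
makes is immaterial). -/
def lengthMeasure : Measure G.Space :=
  (Measure.sum fun e : G.graph.edgeSet =>
    ENNReal.ofReal (G.weight e) •
      (volume.restrict (Set.Icc (0 : ℝ) 1)).map
        (AffineMap.lineMap ((Quot.out (e : Sym2 G.nodes)).1 : EuclideanSpace ℝ (Fin n))
          ((Quot.out (e : Sym2 G.nodes)).2 : EuclideanSpace ℝ (Fin n)))).comap
    (Subtype.val : G.Space → EuclideanSpace ℝ (Fin n))

/-- `h ∈ L^q(G, lam)` is a graph derivative of `f` with respect to `lam`. -/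
def IsGraphDeriv (z₀ : G.nodes) (lam : Measure G.Space) (q : ℝ≥0∞) (f h : G.Space → ℝ) : Prop :=
  MemLp h q lam ∧
    ∀ x, f x - f (G.node z₀) = ∫ y in G.geod (G.node z₀) x, h y ∂lam

/-- The weight function `ŵ(x) = 1 + lam(Λ(x))`. -/
def wHat (z₀ : G.nodes) (lam : Measure G.Space) (x : G.Space) : ℝ≥0∞ := 1 + lam (G.Lam z₀ x)

/-- The ball `B(q, ŵ)`: the functions of the graph-based Sobolev space `W^{1,q}(G, lam)` that vanish
at the root and whose graph derivative has weighted norm at most `1` in `L^q(G, ŵ lam)`. -/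
def sobolevBall (z₀ : G.nodes) (lam : Measure G.Space) (q : ℝ≥0∞) : Set (G.Space → ℝ) :=
  {f | Continuous f ∧ f (G.node z₀) = 0 ∧
    ∃ h, G.IsGraphDeriv z₀ lam q f h ∧ eLpNorm h q (lam.withDensity (G.wHat z₀ lam)) ≤ 1}

/-- The values `|∫ f dμ - ∫ f dν|` over `f ∈ B(p', ŵ)`, where `1/p + 1/p' = 1`. -/
def ipmValues (z₀ : G.nodes) (lam : Measure G.Space) (p : ℝ≥0∞) (μ ν : Measure G.Space) : Set ℝ :=
  (fun f : G.Space → ℝ => |∫ x, f x ∂μ - ∫ y, f y ∂ν|) ''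
    G.sobolevBall z₀ lam (ENNReal.conjExponent p)

/-- The regularized Sobolev IPM of order `p`. -/
def regSobolevIPM (z₀ : G.nodes) (lam : Measure G.Space) (p : ℝ≥0∞) (μ ν : Measure G.Space) : ℝ :=
  sSup (G.ipmValues z₀ lam p μ ν)

/-- The probability measures on the continuous graph that are supported on the nodes. -/
def NodeMeasure : Type :=
  {μ : ProbabilityMeasure G.Space // (μ : Measure G.Space) (Set.range G.node)ᶜ = 0}

/-- The measure underlying an element of `NodeMeasure`. -/
def NodeMeasure.toMeasure {G : PhysicalGraph n} (μ : G.NodeMeasure) : Measure G.Space :=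
  (μ.1 : Measure G.Space)

end PhysicalGraph

/-- Negative definite (real, symmetric) kernels. -/
def IsNegDefKernel {Ω : Type*} (k : Ω → Ω → ℝ) : Prop :=
  (∀ x y, k x y = k y x) ∧
    ∀ (m : ℕ) (x : Fin m → Ω) (c : Fin m → ℝ), ∑ i, c i = 0 →
      ∑ i, ∑ j, c i * c j * k (x i) (x j) ≤ 0

/-- Positive definite (real, symmetric) kernels. -/
def IsPosDefKernel {Ω : Type*} (k : Ω → Ω → ℝ) : Prop :=
  (∀ x y, k x y = k y x) ∧
    ∀ (m : ℕ) (x : Fin m → Ω) (c : Fin m → ℝ), 0 ≤ ∑ i, ∑ j, c i * c j * k (x i) (x j)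

end

/-!
The regularized Sobolev IPM of measures on the nodes is an `L^p` distance, and `L^p` distances are
negative definite for `1 ≤ p ≤ 2`.

*The closed form.* A function `f` in the Sobolev ball is the primitive of its graph derivative `h`
along the shortest paths from the root, and a measure `μ` on the nodes is a finite sum of point
masses. Hence `∫ f dμ = ∫ h(x) μ(Λ(x)) dλ`, and with `φ_μ = μ(Λ(·)) / ŵ` the number
`∫ f dμ - ∫ f dν` is the integral of `h (φ_μ - φ_ν)` with respect to `ŵ λ`. By Hölder's inequality
it is at most the norm of `φ_μ - φ_ν` in `L^p(ŵ λ)`, and the bound is attained at the usual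
extremal function
(`exists_abs_integral_mul_eq`). So the IPM is the norm
(`PhysicalGraph.UniqueShortestPaths.isGreatest_ipmValues`), provided that the primitive of the
extremal function is continuous and that `ŵ` is measurable.

*The geometry.* Both facts rest on the shape of the shortest paths: each edge, in one of its two
directions, leads away from the root, so that the shortest path to any point of the edge runs
through its first endpoint and then along the edge
(`PhysicalGraph.UniqueShortestPaths.isOutward_or`).
An edge without such a direction would have an interior point that is equally far from the root
through either endpoint, which contradicts uniqueness. Since the length measure has no atoms, the
primitive of a bounded function is continuous along each edge, hence on the finite union of the
edges; and the relation `x ∈ [z₀, y]` is measurable in the pair `(x, y)`, hence so is `ŵ`.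

*The kernels.* On the real line `(s - t) ^ 2` is a negative definite kernel. Schoenberg's theorem
turns a negative definite kernel `k` into positive definite kernels `exp (-t k)`. As `x ^ a` for
`0 < a < 1` is a mixture of the functions `1 - exp (-x s)`, the powers `k ^ a` of a nonnegative
negative definite kernel are negative definite (`IsNegDefKernel.rpow`). With `a = p / 2` this gives
`|s - t| ^ p`; integration gives the `p`-th power of the IPM; and `a = 1 / p` gives the IPM itself.
-/

/-! ### Positive and negative definite kernels -/

section Kernels

variable {Ω : Type*} {k l : Ω → Ω → ℝ}

theorem IsPosDefKernel.rankOne {f : Ω → ℝ} : IsPosDefKernel fun x y => f x * f y := by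
  refine ⟨fun x y => mul_comm _ _, fun m x c => ?_⟩
  have : ∑ i, ∑ j, c i * c j * (f (x i) * f (x j)) = (∑ i, c i * f (x i)) ^ 2 := by
    rw [sq, Finset.sum_mul_sum]
    exact Finset.sum_congr rfl fun i _ => Finset.sum_congr rfl fun j _ => by ring
  rw [this]
  positivity

theorem IsPosDefKernel.const_mul (hk : IsPosDefKernel k) {a : ℝ} (ha : 0 ≤ a) :
    IsPosDefKernel fun x y => a * k x y := by
  refine ⟨fun x y => by simp only [hk.1 x y], fun m x c => ?_⟩
  have : ∑ i, ∑ j, c i * c j * (a * k (x i) (x j)) = a * ∑ i, ∑ j, c i * c j * k (x i) (x j) := by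
    simp only [Finset.mul_sum]
    exact Finset.sum_congr rfl fun i _ => Finset.sum_congr rfl fun j _ => by ring
  rw [this]
  exact mul_nonneg ha (hk.2 m x c)

theorem IsPosDefKernel.finset_sum {ι : Type*} (s : Finset ι) {k : ι → Ω → Ω → ℝ}
    (hk : ∀ r ∈ s, IsPosDefKernel (k r)) : IsPosDefKernel fun x y => ∑ r ∈ s, k r x y := by
  refine ⟨fun x y => Finset.sum_congr rfl fun r hr => (hk r hr).1 x y, fun m x c => ?_⟩
  have : ∑ i, ∑ j, c i * c j * ∑ r ∈ s, k r (x i) (x j) =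
      ∑ r ∈ s, ∑ i, ∑ j, c i * c j * k r (x i) (x j) := by
    simp only [Finset.mul_sum]
    rw [Finset.sum_comm]
    simp only [Finset.sum_comm (s := s)]
    rw [Finset.sum_comm]
  rw [this]
  exact Finset.sum_nonneg fun r hr => (hk r hr).2 m x c

theorem IsPosDefKernel.mul (hk : IsPosDefKernel k) (hl : IsPosDefKernel l) :
    IsPosDefKernel fun x y => k x y * l x y := by
  have key : ∀ {k : Ω → Ω → ℝ}, IsPosDefKernel k → ∀ {m : ℕ} (x : Fin m → Ω),
      (Matrix.of fun i j => k (x i) (x j)).PosSemidef := by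
    intro k hk m x
    refine Matrix.PosSemidef.of_dotProduct_mulVec_nonneg ?_ fun c => ?_
    · ext i j
      simp [hk.1 (x j) (x i)]
    · have := hk.2 m x c
      simp only [dotProduct, Matrix.mulVec, Matrix.of_apply, Finset.mul_sum, star_trivial]
      refine this.trans_eq ?_
      exact Finset.sum_congr rfl fun i _ => Finset.sum_congr rfl fun j _ => by ring
  refine ⟨fun x y => by simp only [hk.1 x y, hl.1 x y], fun m x c => ?_⟩
  have := ((key hk x).hadamard (key hl x)).dotProduct_mulVec_nonneg c
  simp only [dotProduct, Matrix.mulVec, Matrix.of_apply, Finset.mul_sum, star_trivial,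
    Matrix.hadamard_apply] at this
  refine this.trans_eq ?_
  exact Finset.sum_congr rfl fun i _ => Finset.sum_congr rfl fun j _ => by ring

theorem IsPosDefKernel.pow (hk : IsPosDefKernel k) (r : ℕ) :
    IsPosDefKernel fun x y => k x y ^ r := by
  induction r with
  | zero => simpa using IsPosDefKernel.rankOne (Ω := Ω) (f := fun _ => 1)
  | succ r ih => simpa only [pow_succ] using ih.mul hk

theorem IsPosDefKernel.of_tendsto {K : ℕ → Ω → Ω → ℝ} (hK : ∀ r, IsPosDefKernel (K r))
    (h : ∀ x y, Filter.Tendsto (fun r => K r x y) Filter.atTop (nhds (k x y))) :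
    IsPosDefKernel k := by
  refine ⟨fun x y => tendsto_nhds_unique (h x y) (by simpa only [(hK _).1 x y] using h y x),
    fun m x c => ?_⟩
  have hlim : Filter.Tendsto (fun r => ∑ i, ∑ j, c i * c j * K r (x i) (x j)) Filter.atTop
      (nhds (∑ i, ∑ j, c i * c j * k (x i) (x j))) :=
    tendsto_finsetSum _ fun i _ => tendsto_finsetSum _ fun j _ => (h _ _).const_mul _
  exact ge_of_tendsto' hlim fun r => (hK r).2 m x c

theorem IsPosDefKernel.exp (hk : IsPosDefKernel k) :
    IsPosDefKernel fun x y => Real.exp (k x y) := by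
  refine .of_tendsto (K := fun r x y => ∑ i ∈ Finset.range r, (i.factorial : ℝ)⁻¹ * k x y ^ i)
    (fun r => .finset_sum _ fun i _ => (hk.pow i).const_mul (by positivity)) fun x y => ?_
  have := (NormedSpace.expSeries_div_hasSum_exp (k x y)).tendsto_sum_nat
  simpa only [← Real.exp_eq_exp_ℝ, div_eq_inv_mul] using this

/-- The kernel `k(x, o) + k(o, y) - k(x, y) - k(o, o)` of a negative definite kernel is positive
definite: test `k` on the points `o, x₁, …, x_m` with the weight `-∑ cᵢ` at `o`. -/
theorem IsNegDefKernel.isPosDefKernel_base (hk : IsNegDefKernel k) (o : Ω) :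
    IsPosDefKernel fun x y => k x o + k o y - k x y - k o o := by
  refine ⟨fun x y => by simp only [hk.1 x o, hk.1 o y, hk.1 x y]; ring, fun m x c => ?_⟩
  have h := hk.2 (m + 1) (Fin.cons o x) (Fin.cons (-∑ i, c i) c) (by simp [Fin.sum_univ_succ])
  simp only [Fin.sum_univ_succ, Fin.cons_zero, Fin.cons_succ, Finset.sum_add_distrib] at h
  have e1 : ∑ j, (-∑ i, c i) * c j * k o (x j) = -((∑ i, c i) * ∑ j, c j * k o (x j)) := by
    rw [← neg_mul, Finset.mul_sum]
    exact Finset.sum_congr rfl fun j _ => mul_assoc _ _ _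
  have e2 : ∑ j, c j * (-∑ i, c i) * k (x j) o = -((∑ i, c i) * ∑ j, c j * k o (x j)) := by
    rw [← e1]
    exact Finset.sum_congr rfl fun j _ => by rw [hk.1 (x j) o, mul_comm (c j)]
  have e3 : ∑ i, ∑ j, c i * c j * (k (x i) o + k o (x j) - k (x i) (x j) - k o o) =
      2 * ((∑ i, c i) * ∑ j, c j * k o (x j)) - ∑ i, ∑ j, c i * c j * k (x i) (x j)
        - (∑ i, c i) * (∑ i, c i) * k o o := by
    have a1 : ∑ i, ∑ j, c i * c j * k (x i) o = (∑ i, c i) * ∑ j, c j * k o (x j) := by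
      rw [Finset.sum_comm, Finset.sum_mul_sum]
      exact Finset.sum_congr rfl fun i _ => Finset.sum_congr rfl fun j _ => by
        rw [hk.1 (x j) o]; ring
    have a2 : ∑ i, ∑ j, c i * c j * k o (x j) = (∑ i, c i) * ∑ j, c j * k o (x j) := by
      rw [Finset.sum_mul_sum]
      exact Finset.sum_congr rfl fun i _ => Finset.sum_congr rfl fun j _ => by ring
    have a3 : ∑ i, ∑ j, c i * c j * k o o = (∑ i, c i) * (∑ i, c i) * k o o := by
      rw [Finset.sum_mul_sum, Finset.sum_mul]
      exact Finset.sum_congr rfl fun i _ => by rw [Finset.sum_mul]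
    simp only [mul_sub, mul_add, Finset.sum_sub_distrib, Finset.sum_add_distrib, a1, a2, a3]
    ring
  rw [e3]
  rw [e1, e2] at h
  linarith

/-- **Schoenberg's theorem**, in the direction from negative to positive definite kernels. -/
theorem IsNegDefKernel.isPosDefKernel_exp_neg_mul (hk : IsNegDefKernel k) {t : ℝ} (ht : 0 ≤ t) :
    IsPosDefKernel fun x y => Real.exp (-t * k x y) := by
  rcases isEmpty_or_nonempty Ω with hΩ | ⟨⟨o⟩⟩
  · refine ⟨fun x => hΩ.elim x, fun m x c => ?_⟩
    have : IsEmpty (Fin m) := ⟨fun i => hΩ.elim (x i)⟩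
    simp
  have h := ((hk.isPosDefKernel_base o).const_mul ht).exp
  have h' := (h.mul (.rankOne (f := fun x => Real.exp (-t * k x o)))).const_mul
    (Real.exp_pos (t * k o o)).le
  convert h' using 3 with x y
  rw [← Real.exp_add, ← Real.exp_add, ← Real.exp_add, hk.1 y o]
  congr 1
  ring

end Kernels

/-! ### Fractional powers of negative definite kernels -/

theorem integrableOn_one_sub_exp_neg_mul_rpow {a : ℝ} (ha0 : 0 < a) (ha1 : a < 1) {x : ℝ}
    (hx : 0 ≤ x) :
    IntegrableOn (fun s : ℝ => (1 - Real.exp (-(x * s))) * s ^ (-a - 1)) (Set.Ioi 0) := by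
  have hmeas : Measurable fun s : ℝ => (1 - Real.exp (-(x * s))) * s ^ (-a - 1) := by fun_prop
  rw [← Set.Ioc_union_Ioi_eq_Ioi zero_le_one]
  refine IntegrableOn.union ?_ ?_
  · have h1 : IntegrableOn (fun s : ℝ => x * s ^ (-a)) (Set.Ioc 0 1) := by
      have := (intervalIntegral.intervalIntegrable_rpow' (a := 0) (b := 1) (r := -a)
        (by linarith)).const_mul x
      rwa [intervalIntegrable_iff_integrableOn_Ioc_of_le zero_le_one] at this
    refine Integrable.mono' h1 hmeas.aestronglyMeasurable ?_
    refine (ae_restrict_iff' measurableSet_Ioc).2 (.of_forall fun s hs => ?_)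
    have hs0 : 0 < s := hs.1
    have hle : Real.exp (-(x * s)) ≤ 1 :=
      Real.exp_le_one_iff.2 (neg_nonpos.2 (mul_nonneg hx hs0.le))
    have hge : 1 - Real.exp (-(x * s)) ≤ x * s := by
      have := Real.add_one_le_exp (-(x * s)); linarith
    rw [Real.norm_eq_abs, abs_of_nonneg (mul_nonneg (by linarith) (Real.rpow_nonneg hs0.le _))]
    calc _ ≤ (x * s) * s ^ (-a - 1) := by gcongr
      _ = x * s ^ (-a) := by
        rw [Real.rpow_sub_one hs0.ne']; field_simp
  · have h1 : IntegrableOn (fun s : ℝ => s ^ (-a - 1)) (Set.Ioi 1) :=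
      integrableOn_Ioi_rpow_of_lt (by linarith) one_pos
    refine Integrable.mono' h1 hmeas.aestronglyMeasurable ?_
    refine (ae_restrict_iff' measurableSet_Ioi).2 (.of_forall fun s hs => ?_)
    have hs0 : 0 < s := one_pos.trans hs
    have hle : Real.exp (-(x * s)) ≤ 1 :=
      Real.exp_le_one_iff.2 (neg_nonpos.2 (mul_nonneg hx hs0.le))
    rw [Real.norm_eq_abs, abs_of_nonneg (mul_nonneg (by linarith) (Real.rpow_nonneg hs0.le _))]
    exact mul_le_of_le_one_left (Real.rpow_nonneg hs0.le _)
      (by have := Real.exp_pos (-(x * s)); linarith)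

/-- The normalizing constant of the representation of `x ^ a` as a mixture of `1 - exp (-x s)`. -/
noncomputable def rpowMixtureConst (a : ℝ) : ℝ :=
  ∫ s in Set.Ioi (0 : ℝ), (1 - Real.exp (-s)) * s ^ (-a - 1)

theorem rpowMixtureConst_pos {a : ℝ} (ha0 : 0 < a) (ha1 : a < 1) : 0 < rpowMixtureConst a := by
  have hint := integrableOn_one_sub_exp_neg_mul_rpow ha0 ha1 zero_le_one
  simp only [one_mul] at hint
  have hpos : ∀ s ∈ Set.Ioi (0 : ℝ), 0 < (1 - Real.exp (-s)) * s ^ (-a - 1) := fun s hs =>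
    mul_pos (sub_pos.2 (Real.exp_zero ▸ Real.exp_lt_exp.2 (neg_lt_zero.2 hs)))
      (Real.rpow_pos_of_pos hs _)
  rw [rpowMixtureConst, setIntegral_pos_iff_support_of_nonneg_ae _ hint]
  · have : (Function.support fun s : ℝ => (1 - Real.exp (-s)) * s ^ (-a - 1)) ∩ Set.Ioi 0 =
        Set.Ioi 0 := Set.inter_eq_right.2 fun s hs => (hpos s hs).ne'
    rw [this]
    simp
  · exact (ae_restrict_iff' measurableSet_Ioi).2 (.of_forall fun s hs => (hpos s hs).le)

/-- For `0 < a < 1`, the function `x ^ a` is a mixture of the functions `1 - exp (-x s)`, by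
scaling. For `1 ≤ a` the integrals diverge and the identity holds between junk values. -/
theorem integral_one_sub_exp_neg_mul_rpow {a : ℝ} (ha0 : 0 < a) {x : ℝ} (hx : 0 ≤ x) :
    ∫ s in Set.Ioi (0 : ℝ), (1 - Real.exp (-(x * s))) * s ^ (-a - 1) =
      rpowMixtureConst a * x ^ a := by
  rcases hx.eq_or_lt with rfl | hx
  · simp [Real.zero_rpow ha0.ne']
  have h := integral_comp_mul_left_Ioi
    (fun s : ℝ => (1 - Real.exp (-s)) * s ^ (-a - 1)) 0 hx
  rw [mul_zero] at h
  have e : ∫ s in Set.Ioi (0 : ℝ), (1 - Real.exp (-(x * s))) * (x * s) ^ (-a - 1) =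
      x ^ (-a - 1) * ∫ s in Set.Ioi (0 : ℝ), (1 - Real.exp (-(x * s))) * s ^ (-a - 1) := by
    rw [← integral_const_mul]
    refine setIntegral_congr_fun measurableSet_Ioi fun s hs => ?_
    simp only [Real.mul_rpow hx.le (le_of_lt hs)]
    ring
  rw [e, smul_eq_mul, ← rpowMixtureConst] at h
  have hp : x ^ (-a - 1) = (x ^ a)⁻¹ * x⁻¹ := by
    rw [Real.rpow_sub_one hx.ne', Real.rpow_neg hx.le, div_eq_mul_inv]
  rw [hp] at h
  have : 0 < x ^ a := Real.rpow_pos_of_pos hx _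
  field_simp at h
  linarith

/-- Powers with exponent in `(0, 1]` preserve negative definiteness. -/
theorem IsNegDefKernel.rpow {Ω : Type*} {k : Ω → Ω → ℝ} (hk : IsNegDefKernel k)
    (h0 : ∀ x y, 0 ≤ k x y) {a : ℝ} (ha0 : 0 < a) (ha1 : a ≤ 1) :
    IsNegDefKernel fun x y => k x y ^ a := by
  rcases ha1.eq_or_lt with rfl | ha1
  · simpa using hk
  refine ⟨fun x y => by simp only [hk.1 x y], fun m x c hc => ?_⟩
  have hC := rpowMixtureConst_pos ha0 ha1
  have hint := fun i j => (integrableOn_one_sub_exp_neg_mul_rpow ha0 ha1 (h0 (x i) (x j)))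
  have key : rpowMixtureConst a * ∑ i, ∑ j, c i * c j * k (x i) (x j) ^ a =
      ∫ s in Set.Ioi (0 : ℝ), ∑ i, ∑ j,
        c i * c j * ((1 - Real.exp (-(k (x i) (x j) * s))) * s ^ (-a - 1)) := by
    rw [integral_finsetSum _ fun i _ => integrable_finsetSum _ fun j _ => (hint i j).const_mul _,
      Finset.mul_sum]
    refine Finset.sum_congr rfl fun i _ => ?_
    rw [integral_finsetSum _ fun j _ => (hint i j).const_mul _, Finset.mul_sum]
    refine Finset.sum_congr rfl fun j _ => ?_
    rw [integral_const_mul, integral_one_sub_exp_neg_mul_rpow ha0 (h0 _ _)]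
    ring
  have hneg : ∫ s in Set.Ioi (0 : ℝ), ∑ i, ∑ j,
        c i * c j * ((1 - Real.exp (-(k (x i) (x j) * s))) * s ^ (-a - 1)) ≤ 0 := by
    refine setIntegral_nonpos measurableSet_Ioi fun s hs => ?_
    have hpd := (hk.isPosDefKernel_exp_neg_mul (le_of_lt hs)).2 m x c
    have hone : ∑ i, ∑ j, c i * c j = 0 := by rw [← Finset.sum_mul_sum, hc, zero_mul]
    have : ∑ i, ∑ j, c i * c j * ((1 - Real.exp (-(k (x i) (x j) * s))) * s ^ (-a - 1)) =
        (∑ i, ∑ j, c i * c j - ∑ i, ∑ j, c i * c j * Real.exp (-s * k (x i) (x j))) *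
          s ^ (-a - 1) := by
      simp only [← Finset.sum_sub_distrib, Finset.sum_mul]
      refine Finset.sum_congr rfl fun i _ => Finset.sum_congr rfl fun j _ => ?_
      rw [show -(k (x i) (x j) * s) = -s * k (x i) (x j) by ring]
      ring
    rw [this, hone, zero_sub]
    exact mul_nonpos_of_nonpos_of_nonneg (by linarith) (Real.rpow_nonneg (le_of_lt hs) _)
  rw [← key] at hneg
  exact nonpos_of_mul_nonpos_right hneg hC

theorem isNegDefKernel_sq_sub : IsNegDefKernel fun s t : ℝ => (s - t) ^ 2 := by
  refine ⟨fun s t => by ring, fun m x c hc => ?_⟩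
  have e : ∑ i, ∑ j, c i * c j * (x i - x j) ^ 2 =
      2 * ((∑ i, c i) * ∑ i, c i * x i ^ 2) - 2 * (∑ i, c i * x i) ^ 2 := by
    have a1 : ∑ i, ∑ j, c i * x i ^ 2 * c j = (∑ i, c i) * ∑ i, c i * x i ^ 2 := by
      rw [← Finset.sum_mul_sum, mul_comm]
    have a2 : ∑ i, ∑ j, c i * (c j * x j ^ 2) = (∑ i, c i) * ∑ i, c i * x i ^ 2 := by
      rw [← Finset.sum_mul_sum]
    have a3 : ∑ i, ∑ j, (c i * x i) * (c j * x j) = (∑ i, c i * x i) ^ 2 := by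
      rw [← Finset.sum_mul_sum, sq]
    rw [← a3, two_mul ((∑ i, c i) * _)]
    nth_rw 1 [← a1]
    rw [← a2]
    simp only [Finset.mul_sum, ← Finset.sum_add_distrib, ← Finset.sum_sub_distrib]
    exact Finset.sum_congr rfl fun i _ => Finset.sum_congr rfl fun j _ => by ring
  rw [e, hc]
  have := sq_nonneg (∑ i, c i * x i)
  linarith

theorem isNegDefKernel_abs_sub_rpow {p : ℝ} (hp0 : 0 < p) (hp2 : p ≤ 2) :
    IsNegDefKernel fun s t : ℝ => |s - t| ^ p := by
  have := isNegDefKernel_sq_sub.rpow (fun s t => sq_nonneg (s - t)) (a := p / 2) (by linarith)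
    (by linarith)
  convert this using 3 with s t
  rw [← sq_abs, ← Real.rpow_natCast, ← Real.rpow_mul (abs_nonneg _)]
  congr 1
  push_cast
  ring

theorem isNegDefKernel_integral_abs_sub_rpow {Ω X : Type*} [MeasurableSpace X] (m : Measure X)
    (φ : Ω → X → ℝ) {p : ℝ} (hp0 : 0 < p) (hp2 : p ≤ 2)
    (hint : ∀ i j, Integrable (fun x => |φ i x - φ j x| ^ p) m) :
    IsNegDefKernel fun i j => ∫ x, |φ i x - φ j x| ^ p ∂m := by
  have hk := isNegDefKernel_abs_sub_rpow hp0 hp2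
  refine ⟨fun i j => integral_congr_ae (.of_forall fun x => hk.1 _ _), fun r x c hc => ?_⟩
  have : ∑ i, ∑ j, c i * c j * ∫ y, |φ (x i) y - φ (x j) y| ^ p ∂m =
      ∫ y, ∑ i, ∑ j, c i * c j * |φ (x i) y - φ (x j) y| ^ p ∂m := by
    rw [integral_finsetSum _ fun i _ => integrable_finsetSum _ fun j _ =>
      (hint _ _).const_mul _]
    refine Finset.sum_congr rfl fun i _ => ?_
    rw [integral_finsetSum _ fun j _ => (hint _ _).const_mul _]
    exact Finset.sum_congr rfl fun j _ => (integral_const_mul _ _).symm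
  rw [this]
  exact integral_nonpos fun y => hk.2 r (fun i => φ (x i) y) c hc

/-! ### Duality of `L^p` norms -/

section Duality

variable {X : Type*} [MeasurableSpace X] {m : Measure X} {g h : X → ℝ} {p : ℝ}

theorem conjExponent_ofReal (hp : 1 < p) :
    ENNReal.conjExponent (ENNReal.ofReal p) = ENNReal.ofReal p.conjExponent := by
  have h : 0 < p - 1 := sub_pos.2 hp
  rw [ENNReal.conjExponent, Real.conjExponent, ← ENNReal.ofReal_one,
    ← ENNReal.ofReal_sub _ zero_le_one, ← ENNReal.ofReal_inv_of_pos h,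
    ← ENNReal.ofReal_add zero_le_one (by positivity)]
  congr 1
  field_simp
  ring

theorem holderConjugate_conjExponent_ofReal (hp : 1 ≤ p) :
    ENNReal.HolderConjugate (ENNReal.conjExponent (ENNReal.ofReal p)) (ENNReal.ofReal p) := by
  rcases hp.eq_or_lt with rfl | hp
  · simp only [ENNReal.ofReal_one, ENNReal.conjExponent, tsub_self, ENNReal.inv_zero, add_top]
    infer_instance
  · rw [conjExponent_ofReal hp]
    exact (Real.HolderConjugate.conjExponent hp).symm.ennrealOfReal

/-- Hölder's inequality for a pair of conjugate exponents of which one may be infinite. -/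
theorem abs_integral_mul_le_of_eLpNorm_le_one (hp : 1 ≤ p) (hg : MemLp g (ENNReal.ofReal p) m)
    (hh : AEStronglyMeasurable h m)
    (h1 : eLpNorm h (ENNReal.conjExponent (ENNReal.ofReal p)) m ≤ 1) :
    |∫ x, h x * g x ∂m| ≤ (∫ x, |g x| ^ p ∂m) ^ (1 / p) := by
  have := holderConjugate_conjExponent_ofReal hp
  have hp0 : 0 < p := one_pos.trans_le hp
  have e1 : eLpNorm (h • g) 1 m ≤ eLpNorm g (ENNReal.ofReal p) m :=
    (eLpNorm_smul_le_mul_eLpNorm (p := ENNReal.conjExponent (ENNReal.ofReal p)) hg.1 hh).trans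
      (mul_le_of_le_one_left' h1)
  have e2 : (eLpNorm g (ENNReal.ofReal p) m).toReal = (∫ x, |g x| ^ p ∂m) ^ (1 / p) := by
    rw [hg.eLpNorm_eq_integral_rpow_norm (by simpa using hp0) ENNReal.ofReal_ne_top,
      ENNReal.toReal_ofReal hp0.le, one_div, ENNReal.toReal_ofReal (by positivity)]
    simp only [Real.norm_eq_abs]
  have e3 : |∫ x, h x * g x ∂m| ≤ (eLpNorm (h • g) 1 m).toReal := by
    rw [eLpNorm_one_eq_lintegral_enorm, ← integral_norm_eq_lintegral_enorm (hh.smul hg.1)]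
    exact norm_integral_le_integral_norm (h • g)
  rw [← e2]
  exact e3.trans (ENNReal.toReal_mono hg.eLpNorm_lt_top.ne e1)

/-- Hölder's inequality is attained at a bounded function when `g` is bounded: the extremal function
is `sign g * |g| ^ (p - 1)`, normalized; for `p = 1` it is `sign g`. -/
theorem exists_abs_integral_mul_eq [IsFiniteMeasure m] (hp : 1 ≤ p) (hg : Measurable g) {C : ℝ}
    (hC : ∀ x, |g x| ≤ C) :
    ∃ h : X → ℝ, Measurable h ∧ (∃ B, ∀ x, |h x| ≤ B) ∧
      eLpNorm h (ENNReal.conjExponent (ENNReal.ofReal p)) m ≤ 1 ∧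
      |∫ x, h x * g x ∂m| = (∫ x, |g x| ^ p ∂m) ^ (1 / p) := by
  have hp0 : 0 < p := one_pos.trans_le hp
  set N := ∫ x, |g x| ^ p ∂m with hN
  have hN0 : 0 ≤ N := integral_nonneg fun x => by positivity
  rcases hN0.eq_or_lt with hN0 | hN0
  · refine ⟨0, measurable_const, ⟨0, by simp⟩, by simp, ?_⟩
    rw [← hN0, Real.zero_rpow (by positivity)]
    simp
  have hsign : Measurable fun x => (SignType.sign (g x) : ℝ) := by
    have : (fun x => (SignType.sign (g x) : ℝ)) =
        fun x => if 0 < g x then 1 else if g x < 0 then -1 else 0 := by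
      ext x
      rw [sign_apply]
      split_ifs <;> simp
    rw [this]
    exact .ite (measurableSet_lt measurable_const hg) measurable_const
      (.ite (measurableSet_lt hg measurable_const) measurable_const measurable_const)
  set h : X → ℝ := fun x => (SignType.sign (g x) : ℝ) * |g x| ^ (p - 1) / N ^ ((p - 1) / p)
  have hNp : 0 < N ^ ((p - 1) / p) := Real.rpow_pos_of_pos hN0 _
  have hs1 : ∀ s : SignType, |(s : ℝ)| ≤ 1 := by
    intro s; cases s <;> simp
  have habs : ∀ x, |h x| ≤ |g x| ^ (p - 1) / N ^ ((p - 1) / p) := by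
    intro x
    simp only [h, abs_div, abs_mul, abs_of_pos hNp]
    gcongr
    rw [abs_of_nonneg (Real.rpow_nonneg (abs_nonneg _) _)]
    exact mul_le_of_le_one_left (by positivity) (hs1 _)
  have hhm : Measurable h :=
    (hsign.mul (hg.abs.pow_const _)).div_const _
  have hbd : ∀ x, |h x| ≤ C ^ (p - 1) / N ^ ((p - 1) / p) := fun x => by
    refine (habs x).trans ?_
    have := sub_nonneg.2 hp
    gcongr
    exact hC x
  refine ⟨h, hhm, ⟨_, hbd⟩, ?_, ?_⟩
  · rcases hp.eq_or_lt with rfl | hp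
    · have : ENNReal.conjExponent (ENNReal.ofReal 1) = ∞ := by simp [ENNReal.conjExponent]
      rw [this, eLpNorm_exponent_top]
      refine (eLpNormEssSup_le_of_ae_bound (C := 1) (.of_forall fun x => ?_)).trans (by simp)
      simpa using habs x
    · rw [conjExponent_ofReal hp]
      have hpq := Real.HolderConjugate.conjExponent hp
      set q := p.conjExponent
      have hm : MemLp h (ENNReal.ofReal q) m :=
        MemLp.of_bound hhm.aestronglyMeasurable _ (.of_forall hbd)
      rw [hm.eLpNorm_eq_integral_rpow_norm (by simpa using hpq.symm.pos) ENNReal.ofReal_ne_top,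
        ENNReal.toReal_ofReal hpq.symm.nonneg]
      refine ENNReal.ofReal_le_one.2 (Real.rpow_le_one (by positivity) ?_
        (inv_nonneg.2 hpq.symm.nonneg))
      have hle : ∀ x, ‖h x‖ ^ q ≤ |g x| ^ p / N := by
        intro x
        calc ‖h x‖ ^ q ≤ (|g x| ^ (p - 1) / N ^ ((p - 1) / p)) ^ q :=
              Real.rpow_le_rpow (norm_nonneg _) (habs x) hpq.symm.nonneg
          _ = |g x| ^ p / N := by
            have e : (p - 1) * q = p := hpq.sub_one_mul_conj
            rw [Real.div_rpow (by positivity) hNp.le, ← Real.rpow_mul (abs_nonneg _),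
              ← Real.rpow_mul hN0.le, e, div_mul_eq_mul_div, e, div_self hp0.ne', Real.rpow_one]
      have hgint : Integrable (fun x => |g x| ^ p) m := by
        refine Integrable.of_bound (hg.abs.pow_const _).aestronglyMeasurable (C ^ p)
          (.of_forall fun x => ?_)
        rw [Real.norm_eq_abs, abs_of_nonneg (by positivity)]
        exact Real.rpow_le_rpow (abs_nonneg _) (hC x) hp0.le
      calc ∫ x, ‖h x‖ ^ q ∂m ≤ ∫ x, |g x| ^ p / N ∂m :=
            integral_mono_of_nonneg (.of_forall fun x => by positivity) (hgint.div_const _)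
              (.of_forall hle)
        _ = 1 := by rw [integral_div, ← hN, div_self hN0.ne']
  · have e : ∀ x, h x * g x = |g x| ^ p / N ^ ((p - 1) / p) := by
      intro x
      have : (SignType.sign (g x) : ℝ) * g x = |g x| := sign_mul_self _
      calc h x * g x = ((SignType.sign (g x) : ℝ) * g x) * |g x| ^ (p - 1) / N ^ ((p - 1) / p) := by
            simp only [h]; ring
        _ = _ := by
          rw [this]
          congr 1
          rcases (abs_nonneg (g x)).eq_or_lt with h0 | h0
          · rw [← h0, zero_mul, Real.zero_rpow hp0.ne']
          · rw [Real.rpow_sub_one h0.ne']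
            field_simp
    simp only [e]
    rw [integral_div, ← hN, abs_of_pos (by positivity), div_eq_iff hNp.ne', ← Real.rpow_add hN0]
    rw [show 1 / p + (p - 1) / p = 1 by field_simp; ring, Real.rpow_one]

end Duality

/-! ### Paths and the distance from the root -/

namespace PhysicalGraph

variable {n : ℕ} {G : PhysicalGraph n} {z₀ : G.nodes}

theorem coe_ne_of_adj {u v : G.nodes} (h : G.graph.Adj u v) :
    (u : EuclideanSpace ℝ (Fin n)) ≠ v := fun e => h.ne (Subtype.ext e)

namespace GPath

theorem length_nonneg {x z : G.Space} (γ : G.GPath x z) : 0 ≤ γ.length := by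
  induction γ with
  | nil x => exact le_rfl
  | cons u v h hx hy rest ih =>
    have := (G.weight_pos s(u, v) h).le
    exact add_nonneg (by positivity) ih

theorem start_mem_trace {x z : G.Space} (γ : G.GPath x z) : x ∈ γ.trace := by
  cases γ with
  | nil => exact rfl
  | cons u v h hx hy rest => exact Or.inl (left_mem_segment _ _ _)

/-- Concatenation of paths. -/
def append : {x y z : G.Space} → G.GPath x y → G.GPath y z → G.GPath x z
  | _, _, _, .nil _, δ => δ
  | _, _, _, .cons u v h hx hy rest, δ => .cons u v h hx hy (rest.append δ)

theorem length_append {x y z : G.Space} (γ : G.GPath x y) (δ : G.GPath y z) :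
    (γ.append δ).length = γ.length + δ.length := by
  induction γ with
  | nil x => simp [append, length]
  | cons u v h hx hy rest ih => simp only [append, length, ih, add_assoc]

theorem trace_append {x y z : G.Space} (γ : G.GPath x y) (δ : G.GPath y z) :
    (γ.append δ).trace = γ.trace ∪ δ.trace := by
  induction γ with
  | nil x => simpa [append, trace] using (Set.insert_eq_self.2 δ.start_mem_trace).symm
  | cons u v h hx hy rest ih => simp only [append, trace, ih, Set.union_assoc]

/-- The path that runs straight from `x` to `y` inside one edge. -/
def single {x y : G.Space} (u v : G.nodes) (h : G.graph.Adj u v)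
    (hx : (x : EuclideanSpace ℝ (Fin n)) ∈ segment ℝ (u : EuclideanSpace ℝ (Fin n)) v)
    (hy : (y : EuclideanSpace ℝ (Fin n)) ∈ segment ℝ (u : EuclideanSpace ℝ (Fin n)) v) :
    G.GPath x y := .cons u v h hx hy (.nil y)

theorem length_single {x y : G.Space} (u v : G.nodes) (h : G.graph.Adj u v)
    (hx : (x : EuclideanSpace ℝ (Fin n)) ∈ segment ℝ (u : EuclideanSpace ℝ (Fin n)) v)
    (hy : (y : EuclideanSpace ℝ (Fin n)) ∈ segment ℝ (u : EuclideanSpace ℝ (Fin n)) v) :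
    (single u v h hx hy).length = G.weight s(u, v) *
      (dist (x : EuclideanSpace ℝ (Fin n)) y / dist (u : EuclideanSpace ℝ (Fin n)) v) :=
  add_zero _

theorem trace_single {x y : G.Space} (u v : G.nodes) (h : G.graph.Adj u v)
    (hx : (x : EuclideanSpace ℝ (Fin n)) ∈ segment ℝ (u : EuclideanSpace ℝ (Fin n)) v)
    (hy : (y : EuclideanSpace ℝ (Fin n)) ∈ segment ℝ (u : EuclideanSpace ℝ (Fin n)) v) :
    (single u v h hx hy).trace =
      {q : G.Space | (q : EuclideanSpace ℝ (Fin n)) ∈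
        segment ℝ (x : EuclideanSpace ℝ (Fin n)) y} := by
  simp only [single, trace, Set.union_singleton]
  exact Set.insert_eq_self.2 (right_mem_segment _ _ _)

theorem step_length {x y : G.Space} {u v : G.nodes} (h : G.graph.Adj u v) {s r : ℝ}
    (hx : (x : EuclideanSpace ℝ (Fin n)) = AffineMap.lineMap (u : EuclideanSpace ℝ (Fin n)) v s)
    (hy : (y : EuclideanSpace ℝ (Fin n)) = AffineMap.lineMap (u : EuclideanSpace ℝ (Fin n)) v r) :
    dist (x : EuclideanSpace ℝ (Fin n)) y / dist (u : EuclideanSpace ℝ (Fin n)) v = |s - r| := by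
  rw [hx, hy, dist_lineMap_lineMap, mul_div_cancel_right₀ _ (dist_ne_zero.2 (coe_ne_of_adj h)),
    Real.dist_eq]

theorem exists_length_le_of_mem_trace {x z : G.Space} (γ : G.GPath x z) {q : G.Space}
    (hq : q ∈ γ.trace) : ∃ δ : G.GPath x q, δ.length ≤ γ.length := by
  induction γ with
  | nil x =>
    obtain rfl : q = x := hq
    exact ⟨.nil q, le_rfl⟩
  | @cons x y z u v h hx hy rest ih =>
    have hw := (G.weight_pos s(u, v) h).le
    rcases hq with hq | hq
    · have hq' : (q : EuclideanSpace ℝ (Fin n)) ∈ segment ℝ (u : EuclideanSpace ℝ (Fin n)) v :=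
        (convex_segment _ _).segment_subset hx hy hq
      refine ⟨single u v h hx hq', ?_⟩
      have hd : dist (x : EuclideanSpace ℝ (Fin n)) q ≤ dist (x : EuclideanSpace ℝ (Fin n)) y := by
        have := dist_add_dist_of_mem_segment hq
        have : 0 ≤ dist (q : EuclideanSpace ℝ (Fin n)) y := dist_nonneg
        linarith
      have := rest.length_nonneg
      rw [length_single]
      refine le_add_of_le_of_nonneg ?_ this
      gcongr
    · obtain ⟨δ, hδ⟩ := ih hq
      exact ⟨.cons u v h hx hy δ, by simpa only [length, add_le_add_iff_left] using hδ⟩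

end GPath

variable (z₀) in
/-- The length of a shortest path from the root to `x`. -/
noncomputable def rootDist (x : G.Space) : ℝ := ⨅ γ : G.GPath (G.node z₀) x, γ.length

theorem rootDist_le_length {x : G.Space} (γ : G.GPath (G.node z₀) x) :
    rootDist z₀ x ≤ γ.length :=
  ciInf_le ⟨0, by rintro _ ⟨γ', rfl⟩; exact γ'.length_nonneg⟩ γ

theorem UniqueShortestPaths.exists_length_eq (hG : G.UniqueShortestPaths z₀) (x : G.Space) :
    ∃ γ : G.GPath (G.node z₀) x, γ.length = rootDist z₀ x := by
  obtain ⟨P, ⟨γ, hγ, -⟩, -⟩ := hG x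
  have : Nonempty (G.GPath (G.node z₀) x) := ⟨γ⟩
  exact ⟨γ, le_antisymm (le_ciInf hγ) (rootDist_le_length γ)⟩

theorem UniqueShortestPaths.geod_eq_trace (hG : G.UniqueShortestPaths z₀) {x : G.Space}
    (γ : G.GPath (G.node z₀) x) (hγ : γ.length = rootDist z₀ x) :
    G.geod (G.node z₀) x = γ.trace := by
  have hs : G.IsShortestPath (G.node z₀) x γ.trace :=
    ⟨γ, fun γ' => hγ.trans_le (rootDist_le_length γ'), rfl⟩
  ext q
  refine ⟨fun ⟨P, hP, hq⟩ => ?_, fun hq => ⟨_, hs, hq⟩⟩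
  rwa [(hG x).unique hs hP]

theorem UniqueShortestPaths.rootDist_le_of_mem_geod (hG : G.UniqueShortestPaths z₀) {x q : G.Space}
    (hq : q ∈ G.geod (G.node z₀) x) : rootDist z₀ q ≤ rootDist z₀ x := by
  obtain ⟨γ, hγ⟩ := hG.exists_length_eq x
  rw [hG.geod_eq_trace γ hγ] at hq
  obtain ⟨δ, hδ⟩ := γ.exists_length_le_of_mem_trace hq
  exact (rootDist_le_length δ).trans (hδ.trans_eq hγ)

theorem mem_segment_of_eq_lineMap {x u v : EuclideanSpace ℝ (Fin n)} {t : ℝ}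
    (ht : t ∈ Set.Icc (0 : ℝ) 1) (hx : x = AffineMap.lineMap u v t) : x ∈ segment ℝ u v := by
  rw [segment_eq_image_lineMap, hx]
  exact Set.mem_image_of_mem _ ht

/-- The path that follows `γ` to the endpoint `u` of an edge and continues inside that edge. -/
theorem exists_append_edge {u v : G.nodes} (h : G.graph.Adj u v) {t : ℝ}
    (ht : t ∈ Set.Icc (0 : ℝ) 1) {x : G.Space}
    (hx : (x : EuclideanSpace ℝ (Fin n)) = AffineMap.lineMap (u : EuclideanSpace ℝ (Fin n)) v t)
    (γ : G.GPath (G.node z₀) (G.node u)) :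
    ∃ δ : G.GPath (G.node z₀) x, δ.length = γ.length + G.weight s(u, v) * t ∧
      δ.trace = γ.trace ∪ {q : G.Space | (q : EuclideanSpace ℝ (Fin n)) ∈
        segment ℝ (u : EuclideanSpace ℝ (Fin n)) x} := by
  have hu : (G.node u : EuclideanSpace ℝ (Fin n)) ∈
      segment ℝ (u : EuclideanSpace ℝ (Fin n)) v := left_mem_segment _ _ _
  refine ⟨γ.append (.single u v h hu (mem_segment_of_eq_lineMap ht hx)), ?_, ?_⟩
  · rw [GPath.length_append, GPath.length_single,
      GPath.step_length h (s := 0) (r := t) (by simp [node]) hx]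
    simp [abs_of_nonneg ht.1]
  · rw [GPath.trace_append, GPath.trace_single]
    rfl

theorem UniqueShortestPaths.rootDist_le_add (hG : G.UniqueShortestPaths z₀) {u v : G.nodes}
    (h : G.graph.Adj u v) {t : ℝ} (ht : t ∈ Set.Icc (0 : ℝ) 1) {x : G.Space}
    (hx : (x : EuclideanSpace ℝ (Fin n)) = AffineMap.lineMap (u : EuclideanSpace ℝ (Fin n)) v t) :
    rootDist z₀ x ≤ rootDist z₀ (G.node u) + G.weight s(u, v) * t := by
  obtain ⟨γ, hγ⟩ := hG.exists_length_eq (G.node u)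
  obtain ⟨δ, hδ, -⟩ := exists_append_edge h ht hx γ
  rw [← hγ, ← hδ]
  exact rootDist_le_length δ

theorem UniqueShortestPaths.rootDist_node_le (hG : G.UniqueShortestPaths z₀) {u v : G.nodes}
    (h : G.graph.Adj u v) :
    rootDist z₀ (G.node v) ≤ rootDist z₀ (G.node u) + G.weight s(u, v) := by
  simpa using hG.rootDist_le_add h (t := 1) (by simp) (x := G.node v) (by simp [node])

variable (z₀) in
/-- Whatever edge the point `x` lies on, one of the endpoints of the edge can be reached from the
root, and from there the point `x` inside the edge, within length `ℓ`. -/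
def ReachedWithin (x : G.Space) (ℓ : ℝ) : Prop :=
  ∀ u v : G.nodes, G.graph.Adj u v → ∀ t ∈ Set.Icc (0 : ℝ) 1,
    (x : EuclideanSpace ℝ (Fin n)) = AffineMap.lineMap (u : EuclideanSpace ℝ (Fin n)) v t →
    rootDist z₀ (G.node u) + G.weight s(u, v) * t ≤ ℓ ∨
      rootDist z₀ (G.node v) + G.weight s(u, v) * (1 - t) ≤ ℓ

theorem lineMap_eq_left_iff {u v : G.nodes} (h : G.graph.Adj u v) {t : ℝ} :
    AffineMap.lineMap (u : EuclideanSpace ℝ (Fin n)) (v : EuclideanSpace ℝ (Fin n)) t = u ↔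
      t = 0 := by
  simp [coe_ne_of_adj h]

theorem lineMap_eq_right_iff {u v : G.nodes} (h : G.graph.Adj u v) {t : ℝ} :
    AffineMap.lineMap (u : EuclideanSpace ℝ (Fin n)) (v : EuclideanSpace ℝ (Fin n)) t = v ↔
      t = 1 := by
  simp [coe_ne_of_adj h]

theorem UniqueShortestPaths.reachedWithin_step (hG : G.UniqueShortestPaths z₀) {x y : G.Space}
    {ℓ : ℝ} (H : ReachedWithin z₀ x ℓ) {u₀ v₀ : G.nodes} (h₀ : G.graph.Adj u₀ v₀)
    (hx : (x : EuclideanSpace ℝ (Fin n)) ∈ segment ℝ (u₀ : EuclideanSpace ℝ (Fin n)) v₀)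
    (hy : (y : EuclideanSpace ℝ (Fin n)) ∈ segment ℝ (u₀ : EuclideanSpace ℝ (Fin n)) v₀) :
    ReachedWithin z₀ y (ℓ + G.weight s(u₀, v₀) * (dist (x : EuclideanSpace ℝ (Fin n)) y /
      dist (u₀ : EuclideanSpace ℝ (Fin n)) v₀)) := by
  rw [segment_eq_image_lineMap] at hx hy
  obtain ⟨s, hs, hx⟩ := hx
  obtain ⟨r, hr, hy⟩ := hy
  rw [GPath.step_length h₀ hx.symm hy.symm]
  have hw := G.weight_pos s(u₀, v₀) h₀
  set w := G.weight s(u₀, v₀)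
  have K : rootDist z₀ (G.node u₀) + w * r ≤ ℓ + w * |s - r| ∨
      rootDist z₀ (G.node v₀) + w * (1 - r) ≤ ℓ + w * |s - r| := by
    rcases H u₀ v₀ h₀ s hs hx.symm with H | H
    · have := mul_le_mul_of_nonneg_left (neg_abs_le (s - r)) hw.le
      left; linarith
    · have := mul_le_mul_of_nonneg_left (le_abs_self (s - r)) hw.le
      right; linarith
  intro u v h t ht hyt
  by_cases hsame : s(u, v) = s(u₀, v₀)
  · rcases Sym2.eq_iff.1 hsame with ⟨rfl, rfl⟩ | ⟨rfl, rfl⟩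
    · obtain rfl : r = t := AffineMap.lineMap_injective ℝ (coe_ne_of_adj h) (hy.trans hyt)
      exact K
    · rw [← AffineMap.lineMap_apply_one_sub] at hyt
      obtain rfl : r = 1 - t := AffineMap.lineMap_injective ℝ (coe_ne_of_adj h₀) (hy.trans hyt)
      rw [hsame]
      rw [sub_sub_cancel] at K
      exact K.symm
  · -- The point `y` is a common endpoint of two edges.
    have hcross := G.noncrossing u v u₀ v₀ h h₀ hsame
      ⟨mem_segment_of_eq_lineMap ht hyt, mem_segment_of_eq_lineMap hr hy.symm⟩
    have hnode : ∀ a : G.nodes, (y : EuclideanSpace ℝ (Fin n)) = a →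
        rootDist z₀ (G.node a) ≤ ℓ + w * |s - r| := by
      intro a ha
      rcases hcross.2 with hc | hc
      · obtain rfl : a = u₀ := Subtype.ext (ha.symm.trans hc)
        obtain rfl : r = 0 := (lineMap_eq_left_iff h₀).1 (hy.trans hc)
        have := hG.rootDist_node_le h₀.symm
        rw [Sym2.eq_swap] at this
        rcases K with K | K <;> linarith
      · obtain rfl : a = v₀ := Subtype.ext (ha.symm.trans hc)
        obtain rfl : r = 1 := (lineMap_eq_right_iff h₀).1 (hy.trans hc)
        have := hG.rootDist_node_le h₀
        rcases K with K | K <;> linarith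
    rcases hcross.1 with hc | hc
    · obtain rfl : t = 0 := (lineMap_eq_left_iff h).1 (hyt.symm.trans hc)
      left
      simpa using hnode u hc
    · obtain rfl : t = 1 := (lineMap_eq_right_iff h).1 (hyt.symm.trans hc)
      right
      simpa using hnode v hc

theorem UniqueShortestPaths.reachedWithin_of_path (hG : G.UniqueShortestPaths z₀) {x z : G.Space}
    (γ : G.GPath x z) : ∀ {ℓ : ℝ}, ReachedWithin z₀ x ℓ → ReachedWithin z₀ z (ℓ + γ.length) := by
  induction γ with
  | nil x => intro ℓ H; simpa [GPath.length] using H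
  | cons u v h hx hy rest ih =>
    intro ℓ H
    rw [GPath.length, ← add_assoc]
    exact ih (hG.reachedWithin_step H h hx hy)

/-- A node that lies on an edge is an endpoint of it. -/
theorem node_eq_of_mem_segment {a u v : G.nodes} (h : G.graph.Adj u v)
    (ha : (a : EuclideanSpace ℝ (Fin n)) ∈ segment ℝ (u : EuclideanSpace ℝ (Fin n)) v) :
    a = u ∨ a = v := by
  by_contra! hne
  have : Nontrivial G.nodes := ⟨a, u, hne.1⟩
  obtain ⟨b, hb⟩ := G.connected.preconnected.exists_adj_of_nontrivial a
  have hs : s(u, v) ≠ s(a, b) := by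
    intro e
    rcases Sym2.eq_iff.1 e with ⟨e, -⟩ | ⟨-, e⟩
    · exact hne.1 e.symm
    · exact hne.2 e.symm
  rcases (G.noncrossing u v a b h hb hs ⟨ha, left_mem_segment _ _ _⟩).1 with hc | hc
  · exact hne.1 (Subtype.ext hc)
  · exact hne.2 (Subtype.ext hc)

theorem reachedWithin_root : ReachedWithin z₀ (G.node z₀) 0 := by
  have h0 : rootDist z₀ (G.node z₀) ≤ 0 := rootDist_le_length (.nil _)
  intro u v h t ht hx
  rcases node_eq_of_mem_segment h (mem_segment_of_eq_lineMap ht hx) with rfl | rfl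
  · obtain rfl : t = 0 := (lineMap_eq_left_iff h).1 hx.symm
    left; simpa using h0
  · obtain rfl : t = 1 := (lineMap_eq_right_iff h).1 hx.symm
    right; simpa using h0

theorem UniqueShortestPaths.reachedWithin_length (hG : G.UniqueShortestPaths z₀) {x : G.Space}
    (γ : G.GPath (G.node z₀) x) : ReachedWithin z₀ x γ.length := by
  simpa using hG.reachedWithin_of_path γ reachedWithin_root

/-- If going through the endpoint `u` is the better way to reach a point of the edge, then the
shortest path to that point goes through `u`. -/
theorem UniqueShortestPaths.geod_eq_of_le (hG : G.UniqueShortestPaths z₀) {u v : G.nodes}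
    (h : G.graph.Adj u v) {t : ℝ} (ht : t ∈ Set.Icc (0 : ℝ) 1) {x : G.Space}
    (hx : (x : EuclideanSpace ℝ (Fin n)) = AffineMap.lineMap (u : EuclideanSpace ℝ (Fin n)) v t)
    (hle : rootDist z₀ (G.node u) + G.weight s(u, v) * t ≤
      rootDist z₀ (G.node v) + G.weight s(u, v) * (1 - t)) :
    rootDist z₀ x = rootDist z₀ (G.node u) + G.weight s(u, v) * t ∧
      G.geod (G.node z₀) x = G.geod (G.node z₀) (G.node u) ∪
        {q : G.Space | (q : EuclideanSpace ℝ (Fin n)) ∈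
          segment ℝ (u : EuclideanSpace ℝ (Fin n)) x} := by
  have hD : rootDist z₀ x = rootDist z₀ (G.node u) + G.weight s(u, v) * t := by
    refine le_antisymm (hG.rootDist_le_add h ht hx) ?_
    obtain ⟨γ, hγ⟩ := hG.exists_length_eq x
    rw [← hγ]
    rcases hG.reachedWithin_length γ u v h t ht hx with H | H
    · exact H
    · exact hle.trans H
  refine ⟨hD, ?_⟩
  obtain ⟨γ, hγ⟩ := hG.exists_length_eq (G.node u)
  obtain ⟨δ, hδ, hδt⟩ := exists_append_edge h ht hx γ
  rw [hG.geod_eq_trace γ hγ, ← hδt, hG.geod_eq_trace δ (by rw [hδ, hγ, hD])]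

variable (z₀) in
/-- The edge from `u` to `v` leads away from the root: the shortest path to any of its points goes
through `u` and then along the edge. -/
def IsOutward (u v : G.nodes) : Prop :=
  G.graph.Adj u v ∧ ∀ x : G.Space,
    (x : EuclideanSpace ℝ (Fin n)) ∈ segment ℝ (u : EuclideanSpace ℝ (Fin n)) v →
    G.geod (G.node z₀) x = G.geod (G.node z₀) (G.node u) ∪
      {q : G.Space | (q : EuclideanSpace ℝ (Fin n)) ∈
        segment ℝ (u : EuclideanSpace ℝ (Fin n)) x}

theorem UniqueShortestPaths.isOutward_of_rootDist_eq (hG : G.UniqueShortestPaths z₀)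
    {u v : G.nodes} (h : G.graph.Adj u v)
    (he : rootDist z₀ (G.node v) = rootDist z₀ (G.node u) + G.weight s(u, v)) :
    IsOutward z₀ u v := by
  refine ⟨h, fun x hx => ?_⟩
  rw [segment_eq_image_lineMap] at hx
  obtain ⟨t, ht, hx⟩ := hx
  refine (hG.geod_eq_of_le h ht hx.symm ?_).2
  have := mul_nonneg (G.weight_pos s(u, v) h).le (sub_nonneg.2 ht.2)
  rw [he]
  linarith

theorem segment_subset_carrier {u v : G.nodes} (h : G.graph.Adj u v) :
    segment ℝ (u : EuclideanSpace ℝ (Fin n)) v ⊆ G.carrier := fun _ hx =>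
  Or.inr (Set.mem_iUnion.2 ⟨u, Set.mem_iUnion.2 ⟨v, Set.mem_iUnion.2 ⟨h, hx⟩⟩⟩)

/-- The point at fraction `t` of the edge from `u` to `v`, for `t ∈ [0, 1]`. -/
noncomputable def edgePoint {u v : G.nodes} (h : G.graph.Adj u v) (t : Set.Icc (0 : ℝ) 1) :
    G.Space :=
  ⟨AffineMap.lineMap (u : EuclideanSpace ℝ (Fin n)) v (t : ℝ),
    segment_subset_carrier h (mem_segment_of_eq_lineMap t.2 rfl)⟩

theorem edgePoint_mem_segment_iff {u v : G.nodes} (h : G.graph.Adj u v)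
    {s t : Set.Icc (0 : ℝ) 1} :
    (edgePoint h s : EuclideanSpace ℝ (Fin n)) ∈
      segment ℝ (u : EuclideanSpace ℝ (Fin n)) (edgePoint h t) ↔ s ≤ t := by
  have e : segment ℝ (u : EuclideanSpace ℝ (Fin n)) (edgePoint h t) =
      AffineMap.lineMap (u : EuclideanSpace ℝ (Fin n)) (v : EuclideanSpace ℝ (Fin n)) ''
        segment ℝ (0 : ℝ) t := by
    rw [image_segment, AffineMap.lineMap_apply_zero]
    rfl
  rw [e]
  refine (AffineMap.lineMap_injective ℝ (coe_ne_of_adj h)).mem_set_image.trans ?_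
  rw [segment_eq_Icc t.2.1]
  exact ⟨fun H => H.2, fun H => ⟨s.2.1, H⟩⟩

/-- Uniqueness of the shortest paths forces every edge to lead away from the root in one of its two
directions. Otherwise some interior point `x` of the edge is equally far from the root through
either endpoint, and the two ways from the root to `x` have the same point set. So the way through
`u` contains a point strictly between `x` and `v`, which lies on the shortest path to `u`, and
vice versa; comparing distances from the root gives a contradiction. -/
theorem UniqueShortestPaths.isOutward_or (hG : G.UniqueShortestPaths z₀) {u v : G.nodes}
    (h : G.graph.Adj u v) : IsOutward z₀ u v ∨ IsOutward z₀ v u := by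
  have hw := G.weight_pos s(u, v) h
  have h1 := hG.rootDist_node_le h
  have h2 := hG.rootDist_node_le h.symm
  rw [Sym2.eq_swap] at h2
  rcases h1.eq_or_lt with h1 | h1
  · exact .inl (hG.isOutward_of_rootDist_eq h h1)
  rcases h2.eq_or_lt with h2 | h2
  · exact .inr (hG.isOutward_of_rootDist_eq h.symm (by rwa [Sym2.eq_swap]))
  exfalso
  set w := G.weight s(u, v) with hwdef
  set a := rootDist z₀ (G.node u) with ha
  set b := rootDist z₀ (G.node v) with hb
  obtain ⟨t, htw⟩ : ∃ t : ℝ, w * t = (b - a + w) / 2 :=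
    ⟨(b - a + w) / 2 / w, mul_div_cancel₀ _ hw.ne'⟩
  have ht0 : 0 < t := pos_of_mul_pos_right (by rw [htw]; linarith) hw.le
  have ht1 : t < 1 := lt_of_mul_lt_mul_left (a := w) (by rw [htw]; linarith) hw.le
  have swap : ∀ s : ℝ,
      AffineMap.lineMap (u : EuclideanSpace ℝ (Fin n)) (v : EuclideanSpace ℝ (Fin n)) s =
      AffineMap.lineMap (v : EuclideanSpace ℝ (Fin n)) (u : EuclideanSpace ℝ (Fin n)) (1 - s) :=
    fun s => (AffineMap.lineMap_apply_one_sub _ _ _).symm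
  set x := edgePoint h ⟨t, ht0.le, ht1.le⟩ with hx
  have gu := (hG.geod_eq_of_le h (x := x) ⟨ht0.le, ht1.le⟩ rfl
    (by rw [← hwdef, ← ha, ← hb]; linarith)).2
  have gv := (hG.geod_eq_of_le h.symm (x := x) (t := 1 - t) ⟨by linarith, by linarith⟩ (swap t)
    (by rw [Sym2.eq_swap, ← hwdef, ← ha, ← hb]; linarith)).2
  -- A point `s` beyond `x`, seen from `u`, and a point `r` before `x`.
  obtain ⟨s, hts, hs1⟩ := exists_between ht1
  obtain ⟨r, hr0, hrt⟩ := exists_between ht0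
  set y := edgePoint h ⟨s, by linarith, hs1.le⟩ with hy
  set z := edgePoint h ⟨r, hr0.le, by linarith⟩ with hz
  have hws := mul_lt_mul_of_pos_left hts hw
  have hwr := mul_lt_mul_of_pos_left hrt hw
  have Dy := (hG.geod_eq_of_le h.symm (x := y) (t := 1 - s) ⟨by linarith, by linarith⟩ (swap s)
    (by rw [Sym2.eq_swap, ← hwdef, ← ha, ← hb]; linarith)).1
  have Dz := (hG.geod_eq_of_le h (x := z) (t := r) ⟨by linarith, by linarith⟩ rfl
    (by rw [← hwdef, ← ha, ← hb]; linarith)).1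
  rw [Sym2.eq_swap, ← hwdef, ← hb] at Dy
  rw [← hwdef, ← ha] at Dz
  have yx : (y : EuclideanSpace ℝ (Fin n)) ∉ segment ℝ (u : EuclideanSpace ℝ (Fin n)) x :=
    fun H => (not_le_of_gt hts) ((edgePoint_mem_segment_iff h).1 H)
  have flip : ∀ q : Set.Icc (0 : ℝ) 1, edgePoint h q = edgePoint h.symm (unitInterval.symm q) :=
    fun q => Subtype.ext (swap q)
  have yx' : (y : EuclideanSpace ℝ (Fin n)) ∈ segment ℝ (v : EuclideanSpace ℝ (Fin n)) x := by
    rw [hy, hx, flip, flip, edgePoint_mem_segment_iff]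
    exact sub_le_sub_left hts.le 1
  have zx : (z : EuclideanSpace ℝ (Fin n)) ∉ segment ℝ (v : EuclideanSpace ℝ (Fin n)) x := by
    rw [hz, hx, flip, flip, edgePoint_mem_segment_iff]
    exact fun H => not_le_of_gt hrt ((sub_le_sub_iff_left (1 : ℝ)).1 H)
  have zx' : (z : EuclideanSpace ℝ (Fin n)) ∈ segment ℝ (u : EuclideanSpace ℝ (Fin n)) x :=
    (edgePoint_mem_segment_iff h).2 hrt.le
  have hyu : y ∈ G.geod (G.node z₀) (G.node u) :=
    ((gu.symm.trans gv).symm.subset (Or.inr yx')).resolve_right yx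
  have hzv : z ∈ G.geod (G.node z₀) (G.node v) :=
    ((gu.symm.trans gv).subset (Or.inr zx')).resolve_right zx
  have i1 := hG.rootDist_le_of_mem_geod hyu
  have i2 := hG.rootDist_le_of_mem_geod hzv
  have i3 := mul_lt_mul_of_pos_left hs1 hw
  have i4 := mul_pos hw hr0
  linarith

/-! ### The length measure and the weight -/

theorem isClosed_segment_euclidean (a b : EuclideanSpace ℝ (Fin n)) : IsClosed (segment ℝ a b) := by
  rw [segment_eq_image_lineMap]
  exact (isCompact_Icc.image AffineMap.lineMap_continuous).isClosed

variable (G) in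
theorem isClosed_carrier : IsClosed G.carrier := by
  refine G.nodes.finite_toSet.isClosed.union ?_
  exact isClosed_iUnion_of_finite fun u => isClosed_iUnion_of_finite fun v =>
    isClosed_iUnion_of_finite fun _ => isClosed_segment_euclidean _ _

theorem isClosed_coe_mem_segment (a b : EuclideanSpace ℝ (Fin n)) :
    IsClosed {x : G.Space | (x : EuclideanSpace ℝ (Fin n)) ∈ segment ℝ a b} :=
  (isClosed_segment_euclidean a b).preimage continuous_subtype_val

variable (G) in
/-- The length measure, regarded as a measure on the ambient Euclidean space. -/
noncomputable def ambientLengthMeasure : Measure (EuclideanSpace ℝ (Fin n)) :=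
  Measure.sum fun e : G.graph.edgeSet =>
    ENNReal.ofReal (G.weight e) •
      (volume.restrict (Set.Icc (0 : ℝ) 1)).map
        (AffineMap.lineMap ((Quot.out (e : Sym2 G.nodes)).1 : EuclideanSpace ℝ (Fin n))
          ((Quot.out (e : Sym2 G.nodes)).2 : EuclideanSpace ℝ (Fin n)))

theorem lengthMeasure_apply (s : Set G.Space) :
    G.lengthMeasure s = G.ambientLengthMeasure (Subtype.val '' s) :=
  (MeasurableEmbedding.subtype_coe G.isClosed_carrier.measurableSet).comap_apply _ _

instance : IsFiniteMeasure G.lengthMeasure := by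
  refine ⟨?_⟩
  rw [lengthMeasure_apply, ambientLengthMeasure, Measure.sum_apply_of_countable]
  have := Fintype.ofFinite G.graph.edgeSet
  rw [tsum_fintype]
  refine ENNReal.sum_lt_top.2 fun e _ => ?_
  rw [Measure.smul_apply, smul_eq_mul]
  exact ENNReal.mul_lt_top ENNReal.ofReal_lt_top (measure_lt_top _ _)

theorem lengthMeasure_singleton (x : G.Space) : G.lengthMeasure {x} = 0 := by
  rw [lengthMeasure_apply, Set.image_singleton, ambientLengthMeasure,
    Measure.sum_apply_of_countable]
  refine ENNReal.tsum_eq_zero.2 fun e => ?_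
  have hadj : G.graph.Adj (Quot.out (e : Sym2 G.nodes)).1 (Quot.out (e : Sym2 G.nodes)).2 := by
    rw [← SimpleGraph.mem_edgeSet]
    have : s((Quot.out (e : Sym2 G.nodes)).1, (Quot.out (e : Sym2 G.nodes)).2) = e :=
      Quot.out_eq (e : Sym2 G.nodes)
    rw [this]
    exact e.2
  rw [Measure.smul_apply, Measure.map_apply AffineMap.lineMap_continuous.measurable
    (measurableSet_singleton _)]
  have hsub : ((AffineMap.lineMap ((Quot.out (e : Sym2 G.nodes)).1 : EuclideanSpace ℝ (Fin n))
      ((Quot.out (e : Sym2 G.nodes)).2 : EuclideanSpace ℝ (Fin n))) ⁻¹'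
        {(x : EuclideanSpace ℝ (Fin n))} : Set ℝ).Subsingleton :=
    Set.subsingleton_singleton.preimage (AffineMap.lineMap_injective ℝ (coe_ne_of_adj hadj))
  rw [hsub.measure_zero, smul_zero]

theorem GPath.isClosed_trace {x z : G.Space} (γ : G.GPath x z) : IsClosed γ.trace := by
  induction γ with
  | nil x => exact isClosed_singleton
  | cons u v h hx hy rest ih => exact (isClosed_coe_mem_segment _ _).union ih

theorem UniqueShortestPaths.isClosed_geod (hG : G.UniqueShortestPaths z₀) (x : G.Space) :
    IsClosed (G.geod (G.node z₀) x) := by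
  obtain ⟨γ, hγ⟩ := hG.exists_length_eq x
  rw [hG.geod_eq_trace γ hγ]
  exact γ.isClosed_trace

theorem UniqueShortestPaths.geod_root (hG : G.UniqueShortestPaths z₀) :
    G.geod (G.node z₀) (G.node z₀) = {G.node z₀} := by
  have h0 : rootDist z₀ (G.node z₀) ≤ 0 := rootDist_le_length (.nil _)
  obtain ⟨γ, hγ⟩ := hG.exists_length_eq (G.node z₀)
  exact hG.geod_eq_trace (.nil _) (le_antisymm (hγ ▸ γ.length_nonneg) h0)

/-- Every point of the graph is a node or lies on an edge that leads away from the root. -/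
theorem UniqueShortestPaths.eq_node_or_mem_outward (hG : G.UniqueShortestPaths z₀) (x : G.Space) :
    (∃ v, x = G.node v) ∨ ∃ u v, IsOutward z₀ u v ∧
      (x : EuclideanSpace ℝ (Fin n)) ∈ segment ℝ (u : EuclideanSpace ℝ (Fin n)) v := by
  rcases x.2 with hx | hx
  · exact .inl ⟨⟨x, hx⟩, rfl⟩
  · simp only [Set.mem_iUnion] at hx
    obtain ⟨u, v, h, hx⟩ := hx
    rcases hG.isOutward_or h with ho | ho
    · exact .inr ⟨u, v, ho, hx⟩
    · exact .inr ⟨v, u, ho, by rwa [segment_symm]⟩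

/-- The relation "`q` lies on the shortest path from the root to `y`" is measurable. -/
theorem UniqueShortestPaths.measurableSet_mem_geod (hG : G.UniqueShortestPaths z₀) :
    MeasurableSet {z : G.Space × G.Space | z.1 ∈ G.geod (G.node z₀) z.2} := by
  have e : {z : G.Space × G.Space | z.1 ∈ G.geod (G.node z₀) z.2} =
      (⋃ v : G.nodes, G.geod (G.node z₀) (G.node v) ×ˢ {G.node v}) ∪
      ⋃ (u : G.nodes) (v : G.nodes) (_ : IsOutward z₀ u v),
        (Prod.snd ⁻¹' {y : G.Space | (y : EuclideanSpace ℝ (Fin n)) ∈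
          segment ℝ (u : EuclideanSpace ℝ (Fin n)) v}) ∩
        ((Prod.fst ⁻¹' G.geod (G.node z₀) (G.node u)) ∪
        {z : G.Space × G.Space | dist (u : EuclideanSpace ℝ (Fin n)) z.1 +
          dist (z.1 : EuclideanSpace ℝ (Fin n)) z.2 =
            dist (u : EuclideanSpace ℝ (Fin n)) z.2}) := by
    have hout : ∀ {u v : G.nodes}, IsOutward z₀ u v → ∀ z : G.Space × G.Space,
        (z.2 : EuclideanSpace ℝ (Fin n)) ∈ segment ℝ (u : EuclideanSpace ℝ (Fin n)) v →
        (z.1 ∈ G.geod (G.node z₀) z.2 ↔ z.1 ∈ G.geod (G.node z₀) (G.node u) ∨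
          dist (u : EuclideanSpace ℝ (Fin n)) z.1 +
          dist (z.1 : EuclideanSpace ℝ (Fin n)) z.2 = dist (u : EuclideanSpace ℝ (Fin n)) z.2) := by
      intro u v ho z hz
      rw [ho.2 z.2 hz, dist_add_dist_eq_iff, ← mem_segment_iff_wbtw]
      rfl
    ext z
    simp only [Set.mem_ofPred_eq, Set.mem_union, Set.mem_iUnion, Set.mem_prod,
      Set.mem_singleton_iff, Set.mem_inter_iff, Set.mem_preimage, exists_prop]
    constructor
    · intro hz
      rcases hG.eq_node_or_mem_outward z.2 with ⟨v, hv⟩ | ⟨u, v, ho, hs⟩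
      · exact .inl ⟨v, hv ▸ hz, hv⟩
      · exact .inr ⟨u, v, ho, hs, (hout ho z hs).1 hz⟩
    · rintro (⟨v, hz, hv⟩ | ⟨u, v, ho, hs, hz⟩)
      · rwa [hv]
      · exact (hout ho z hs).2 hz
  rw [e]
  refine .union (.iUnion fun v => (hG.isClosed_geod _).measurableSet.prod
    (measurableSet_singleton _)) (.iUnion fun u => .iUnion fun v => .iUnion fun ho =>
    .inter (measurable_snd (isClosed_coe_mem_segment _ _).measurableSet)
      (.union (measurable_fst (hG.isClosed_geod _).measurableSet) ?_))
  exact (isClosed_eq (by fun_prop) (by fun_prop)).measurableSet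

theorem UniqueShortestPaths.measurable_wHat (hG : G.UniqueShortestPaths z₀) (lam : Measure G.Space)
    [SFinite lam] : Measurable (G.wHat z₀ lam) :=
  (measurable_measure_prodMk_left hG.measurableSet_mem_geod).const_add 1

theorem one_le_wHat (lam : Measure G.Space) (x : G.Space) : 1 ≤ G.wHat z₀ lam x := le_self_add

theorem wHat_le (lam : Measure G.Space) (x : G.Space) :
    G.wHat z₀ lam x ≤ 1 + lam Set.univ := by
  unfold wHat
  gcongr
  exact Set.subset_univ _

theorem wHat_lt_top (lam : Measure G.Space) [IsFiniteMeasure lam] (x : G.Space) :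
    G.wHat z₀ lam x < ∞ :=
  (wHat_le lam x).trans_lt (by simp)

instance (lam : Measure G.Space) [IsFiniteMeasure lam] :
    IsFiniteMeasure (lam.withDensity (G.wHat z₀ lam)) := by
  refine isFiniteMeasure_withDensity ((lintegral_mono (wHat_le lam)).trans_lt ?_).ne
  rw [lintegral_const]
  exact ENNReal.mul_lt_top (by simp) (measure_lt_top _ _)

/-! ### Primitives of bounded functions -/

theorem mem_segment_left_iff_dist_le {u v x y : EuclideanSpace ℝ (Fin n)}
    (hx : x ∈ segment ℝ u v) (hy : y ∈ segment ℝ u v) :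
    y ∈ segment ℝ u x ↔ dist u y ≤ dist u x := by
  constructor
  · intro h
    rw [← dist_add_dist_of_mem_segment h]
    exact le_add_of_nonneg_right dist_nonneg
  · intro h
    rcases eq_or_ne u v with rfl | huv
    · simp only [segment_same, Set.mem_singleton_iff] at hx hy
      rw [hx, hy]
      exact left_mem_segment _ _ _
    rw [segment_eq_image_lineMap] at hx hy
    obtain ⟨s, hs, rfl⟩ := hx
    obtain ⟨t, ht, rfl⟩ := hy
    rw [dist_left_lineMap, dist_left_lineMap, Real.norm_of_nonneg hs.1, Real.norm_of_nonneg ht.1,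
      mul_le_mul_iff_left₀ (dist_pos.2 huv)] at h
    have : segment ℝ u (AffineMap.lineMap u v s) =
        AffineMap.lineMap u v '' segment ℝ (0 : ℝ) s := by
      rw [image_segment, AffineMap.lineMap_apply_zero]
    rw [this, segment_eq_Icc hs.1]
    exact Set.mem_image_of_mem _ ⟨ht.1, h⟩

/-- On an edge that leads away from the root, `∫_{[z₀, x]} h` depends continuously on `x`: a point
`y` other than `x₀` lies on the shortest paths to all or to none of the points near `x₀`. -/
theorem UniqueShortestPaths.continuousOn_setIntegral_geod (hG : G.UniqueShortestPaths z₀)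
    {h : G.Space → ℝ} (hm : Measurable h) {B : ℝ} (hB : ∀ x, |h x| ≤ B) {u v : G.nodes}
    (ho : IsOutward z₀ u v) :
    ContinuousOn (fun x => ∫ y in G.geod (G.node z₀) x, h y ∂G.lengthMeasure)
      {x : G.Space | (x : EuclideanSpace ℝ (Fin n)) ∈
        segment ℝ (u : EuclideanSpace ℝ (Fin n)) v} := by
  intro x₀ hx₀
  have hms : ∀ x, MeasurableSet (G.geod (G.node z₀) x) := fun x =>
    (hG.isClosed_geod x).measurableSet
  simp only [← integral_indicator (hms _)]
  refine continuousWithinAt_of_dominated (bound := fun _ => B)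
    (.of_forall fun x => (hm.indicator (hms x)).aestronglyMeasurable)
    (.of_forall fun x => .of_forall fun y => ?_) (integrable_const _) ?_
  · refine (norm_indicator_le_norm_self _ _).trans (hB y)
  have hne : ∀ᵐ y ∂G.lengthMeasure, y ≠ x₀ :=
    compl_mem_ae_iff.2 (lengthMeasure_singleton x₀)
  filter_upwards [hne] with y hy
  have hev : ∀ᶠ x in nhdsWithin x₀ {x : G.Space | (x : EuclideanSpace ℝ (Fin n)) ∈
      segment ℝ (u : EuclideanSpace ℝ (Fin n)) v},
      (y ∈ G.geod (G.node z₀) x ↔ y ∈ G.geod (G.node z₀) x₀) := by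
    by_cases hys : (y : EuclideanSpace ℝ (Fin n)) ∈ segment ℝ (u : EuclideanSpace ℝ (Fin n)) v
    · have hd : dist (u : EuclideanSpace ℝ (Fin n)) y ≠ dist (u : EuclideanSpace ℝ (Fin n)) x₀ := by
        intro hd
        refine hy (Subtype.ext ?_)
        have h1 := (mem_segment_left_iff_dist_le hx₀ hys).2 hd.le
        have h2 := dist_add_dist_of_mem_segment h1
        exact dist_eq_zero.1 (by linarith)
      have hc : Continuous fun x : G.Space => dist (u : EuclideanSpace ℝ (Fin n)) x := by fun_prop
      have hev : ∀ᶠ x : G.Space in nhds x₀, (dist (u : EuclideanSpace ℝ (Fin n)) y ≤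
          dist (u : EuclideanSpace ℝ (Fin n)) x ↔ dist (u : EuclideanSpace ℝ (Fin n)) y ≤
          dist (u : EuclideanSpace ℝ (Fin n)) x₀) := by
        rcases hd.lt_or_gt with hd | hd
        · filter_upwards [hc.continuousAt.eventually_const_lt hd] with x hx
          exact iff_of_true hx.le hd.le
        · filter_upwards [hc.continuousAt.eventually_lt_const hd] with x hx
          exact iff_of_false hx.not_ge hd.not_ge
      filter_upwards [self_mem_nhdsWithin, nhdsWithin_le_nhds hev] with x hx hxe
      rw [ho.2 x hx, ho.2 x₀ hx₀]
      refine or_congr Iff.rfl ?_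
      exact (mem_segment_left_iff_dist_le hx hys).trans
        (hxe.trans (mem_segment_left_iff_dist_le hx₀ hys).symm)
    · have hno : ∀ x : G.Space, (x : EuclideanSpace ℝ (Fin n)) ∈
          segment ℝ (u : EuclideanSpace ℝ (Fin n)) v →
          (y : EuclideanSpace ℝ (Fin n)) ∉ segment ℝ (u : EuclideanSpace ℝ (Fin n)) x :=
        fun x hx hyx => hys ((convex_segment _ _).segment_subset (left_mem_segment _ _ _) hx hyx)
      filter_upwards [self_mem_nhdsWithin] with x hx
      rw [ho.2 x hx, ho.2 x₀ hx₀]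
      exact or_congr Iff.rfl (iff_of_false (hno x hx) (hno x₀ hx₀))
  refine tendsto_const_nhds.congr' ?_
  filter_upwards [hev] with x hx
  by_cases hyx : y ∈ G.geod (G.node z₀) x₀
  · rw [Set.indicator_of_mem hyx, Set.indicator_of_mem (hx.2 hyx)]
  · rw [Set.indicator_of_notMem hyx, Set.indicator_of_notMem fun H => hyx (hx.1 H)]

theorem UniqueShortestPaths.continuous_setIntegral_geod (hG : G.UniqueShortestPaths z₀)
    {h : G.Space → ℝ} (hm : Measurable h) {B : ℝ} (hB : ∀ x, |h x| ≤ B) :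
    Continuous fun x => ∫ y in G.geod (G.node z₀) x, h y ∂G.lengthMeasure := by
  let S : G.nodes ⊕ {e : G.nodes × G.nodes // IsOutward z₀ e.1 e.2} → Set G.Space :=
    Sum.elim (fun v => {G.node v}) fun e => {x : G.Space | (x : EuclideanSpace ℝ (Fin n)) ∈
      segment ℝ (e.1.1 : EuclideanSpace ℝ (Fin n)) e.1.2}
  refine (locallyFinite_of_finite S).continuous ?_ ?_ ?_
  · refine Set.eq_univ_of_forall fun x => Set.mem_iUnion.2 ?_
    rcases hG.eq_node_or_mem_outward x with ⟨v, hv⟩ | ⟨u, v, ho, hs⟩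
    · exact ⟨.inl v, hv⟩
    · exact ⟨.inr ⟨(u, v), ho⟩, hs⟩
  · rintro (v | e)
    · exact isClosed_singleton
    · exact isClosed_coe_mem_segment _ _
  · rintro (v | e)
    · exact continuousOn_singleton _ _
    · exact hG.continuousOn_setIntegral_geod hm hB e.2

theorem UniqueShortestPaths.setIntegral_geod_root (hG : G.UniqueShortestPaths z₀)
    (h : G.Space → ℝ) :
    ∫ y in G.geod (G.node z₀) (G.node z₀), h y ∂G.lengthMeasure = 0 := by
  rw [hG.geod_root]
  exact setIntegral_measure_zero _ (lengthMeasure_singleton _)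

/-! ### The Sobolev IPM of node measures as an `L^p` distance -/

theorem node_injective : Function.Injective G.node := fun _ _ h =>
  Subtype.ext (congrArg (Subtype.val : G.Space → EuclideanSpace ℝ (Fin n)) h)

theorem NodeMeasure.integral_eq_sum (μ : G.NodeMeasure) (f : G.Space → ℝ) :
    ∫ x, f x ∂μ.toMeasure = ∑ v : G.nodes, μ.toMeasure.real {G.node v} * f (G.node v) := by
  classical
  have : IsProbabilityMeasure μ.toMeasure := μ.1.2
  have hr : μ.toMeasure.restrict (Finset.univ.image G.node : Finset G.Space) = μ.toMeasure := by
    refine Measure.restrict_eq_self_of_ae_mem ?_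
    rw [Finset.coe_image, Finset.coe_univ, Set.image_univ]
    exact μ.2
  rw [← hr, setIntegral_finset _ (IntegrableOn.finset), hr,
    Finset.sum_image fun _ _ _ _ h => node_injective h]
  rfl

/-- The function `x ↦ μ(Λ(x)) / ŵ(x)` of a measure `μ` supported on the nodes. The number `μ(Λ(x))`
is written as the total mass of the nodes `v` with `x ∈ [z₀, v]`. -/
noncomputable def NodeMeasure.profile (z₀ : G.nodes) (μ : G.NodeMeasure) (x : G.Space) : ℝ :=
  (∑ v : G.nodes, μ.toMeasure.real {G.node v} *
    (G.geod (G.node z₀) (G.node v)).indicator 1 x) / (G.wHat z₀ G.lengthMeasure x).toReal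

theorem UniqueShortestPaths.measurable_profile (hG : G.UniqueShortestPaths z₀)
    (μ : G.NodeMeasure) : Measurable (μ.profile z₀) := by
  refine .div (Finset.measurable_fun_sum _ fun v _ => .const_mul ?_ _)
    (hG.measurable_wHat _).ennreal_toReal
  exact measurable_one.indicator (hG.isClosed_geod _).measurableSet

theorem one_le_toReal_wHat (x : G.Space) : 1 ≤ (G.wHat z₀ G.lengthMeasure x).toReal := by
  rw [← ENNReal.toReal_one]
  exact ENNReal.toReal_mono (wHat_lt_top _ x).ne (one_le_wHat _ x)

theorem NodeMeasure.abs_profile_le (μ : G.NodeMeasure) (x : G.Space) :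
    |μ.profile z₀ x| ≤ ∑ v : G.nodes, μ.toMeasure.real {G.node v} := by
  rw [profile, abs_div, abs_of_nonneg ENNReal.toReal_nonneg]
  refine (div_le_self (abs_nonneg _) (one_le_toReal_wHat x)).trans
    ((Finset.abs_sum_le_sum_abs _ _).trans (Finset.sum_le_sum fun v _ => ?_))
  rw [abs_mul, abs_of_nonneg measureReal_nonneg]
  refine mul_le_of_le_one_right measureReal_nonneg ?_
  by_cases hx : x ∈ G.geod (G.node z₀) (G.node v) <;> simp [hx]

/-- Integration by parts: the integral of `f` against a measure on the nodes, in terms of a graph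
derivative of `f`. -/
theorem UniqueShortestPaths.integral_eq_integral_mul_profile (hG : G.UniqueShortestPaths z₀)
    (μ : G.NodeMeasure) {f h : G.Space → ℝ} (hh : Integrable h G.lengthMeasure)
    (hf : ∀ x, f x = ∫ y in G.geod (G.node z₀) x, h y ∂G.lengthMeasure) :
    ∫ x, f x ∂μ.toMeasure = ∫ x, h x * μ.profile z₀ x
      ∂G.lengthMeasure.withDensity (G.wHat z₀ G.lengthMeasure) := by
  have hms : ∀ x, MeasurableSet (G.geod (G.node z₀) x) := fun x =>
    (hG.isClosed_geod x).measurableSet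
  rw [μ.integral_eq_sum, integral_withDensity_eq_integral_toReal_smul (hG.measurable_wHat _)
    (.of_forall fun x => wHat_lt_top _ x)]
  have e : ∀ x, (G.wHat z₀ G.lengthMeasure x).toReal • (h x * μ.profile z₀ x) =
      ∑ v : G.nodes, μ.toMeasure.real {G.node v} *
        (G.geod (G.node z₀) (G.node v)).indicator h x := by
    intro x
    have hw : (G.wHat z₀ G.lengthMeasure x).toReal ≠ 0 :=
      (one_pos.trans_le (one_le_toReal_wHat x)).ne'
    rw [NodeMeasure.profile, smul_eq_mul, mul_left_comm, mul_div_cancel₀ _ hw, Finset.mul_sum]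
    refine Finset.sum_congr rfl fun v _ => ?_
    by_cases hx : x ∈ G.geod (G.node z₀) (G.node v) <;> simp [hx, mul_comm]
  simp only [e]
  rw [integral_finsetSum _ fun v _ => (hh.indicator (hms _)).const_mul _]
  refine Finset.sum_congr rfl fun v _ => ?_
  rw [integral_const_mul, integral_indicator (hms _), hf]

/-- The regularized Sobolev IPM of two measures on the nodes is attained, and is the `L^p` distance
of their profiles with respect to the measure `ŵ λ`. -/
theorem UniqueShortestPaths.isGreatest_ipmValues (hG : G.UniqueShortestPaths z₀) {p : ℝ}
    (hp : 1 ≤ p) (μ ν : G.NodeMeasure) :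
    IsGreatest (G.ipmValues z₀ G.lengthMeasure (ENNReal.ofReal p) μ.toMeasure ν.toMeasure)
      ((∫ x, |μ.profile z₀ x - ν.profile z₀ x| ^ p
        ∂G.lengthMeasure.withDensity (G.wHat z₀ G.lengthMeasure)) ^ (1 / p)) := by
  set m := G.lengthMeasure.withDensity (G.wHat z₀ G.lengthMeasure) with hm
  have hac : m ≪ G.lengthMeasure := withDensity_absolutelyContinuous _ _
  have hgm : Measurable fun x => μ.profile z₀ x - ν.profile z₀ x :=
    (hG.measurable_profile μ).sub (hG.measurable_profile ν)
  obtain ⟨C, hC⟩ : ∃ C, ∀ x, |μ.profile z₀ x - ν.profile z₀ x| ≤ C :=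
    ⟨_, fun x => (abs_sub _ _).trans (add_le_add (μ.abs_profile_le x) (ν.abs_profile_le x))⟩
  have hq : 1 ≤ ENNReal.conjExponent (ENNReal.ofReal p) := le_self_add
  have hval : ∀ {f h : G.Space → ℝ}, MemLp h (ENNReal.conjExponent (ENNReal.ofReal p))
      G.lengthMeasure → eLpNorm h (ENNReal.conjExponent (ENNReal.ofReal p)) m ≤ 1 →
      (∀ x, f x = ∫ y in G.geod (G.node z₀) x, h y ∂G.lengthMeasure) →
      ∫ x, f x ∂μ.toMeasure - ∫ x, f x ∂ν.toMeasure =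
        ∫ x, h x * (μ.profile z₀ x - ν.profile z₀ x) ∂m := by
    intro f h hh h1 hf
    have hhm : Integrable h m :=
      MemLp.integrable hq ⟨hh.1.mono_ac hac, h1.trans_lt ENNReal.one_lt_top⟩
    have hmul : ∀ ρ : G.NodeMeasure, Integrable (fun x => h x * ρ.profile z₀ x) m := fun ρ =>
      hhm.mul_bdd (hG.measurable_profile ρ).aestronglyMeasurable
        (.of_forall fun x => ρ.abs_profile_le x)
    rw [hG.integral_eq_integral_mul_profile μ (hh.integrable hq) hf,
      hG.integral_eq_integral_mul_profile ν (hh.integrable hq) hf, ← integral_sub (hmul μ) (hmul ν)]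
    simp only [mul_sub]
  constructor
  · obtain ⟨h, hhm, ⟨B, hB⟩, h1, he⟩ := exists_abs_integral_mul_eq (m := m) hp hgm hC
    have hh : MemLp h (ENNReal.conjExponent (ENNReal.ofReal p)) G.lengthMeasure :=
      MemLp.of_bound hhm.aestronglyMeasurable B (.of_forall hB)
    refine ⟨fun x => ∫ y in G.geod (G.node z₀) x, h y ∂G.lengthMeasure,
      ⟨hG.continuous_setIntegral_geod hhm hB, hG.setIntegral_geod_root h, h, ⟨hh, fun x => ?_⟩, h1⟩,
      ?_⟩
    · simp only [hG.setIntegral_geod_root h, sub_zero]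
    · simp only
      rw [hval hh h1 fun x => rfl, he]
  · rintro _ ⟨f, ⟨-, hf0, h, ⟨hh, hf⟩, h1⟩, rfl⟩
    simp only [hf0, sub_zero] at hf
    simp only
    rw [hval hh h1 hf]
    exact abs_integral_mul_le_of_eLpNorm_le_one hp
      (MemLp.of_bound hgm.aestronglyMeasurable C (.of_forall hC)) (hh.1.mono_ac hac) h1

end PhysicalGraph

/-! ### Negative definiteness of the Sobolev IPM -/

theorem proposition4p6 {n : ℕ} (G : PhysicalGraph n) (z₀ : G.nodes)
    (hG : G.UniqueShortestPaths z₀) (p : ℝ) (hp1 : 1 ≤ p) (hp2 : p ≤ 2) :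
    (∀ μ ν : G.NodeMeasure,
      BddAbove (G.ipmValues z₀ G.lengthMeasure (ENNReal.ofReal p) μ.toMeasure ν.toMeasure)) ∧
    IsNegDefKernel (fun μ ν : G.NodeMeasure =>
      G.regSobolevIPM z₀ G.lengthMeasure (ENNReal.ofReal p) μ.toMeasure ν.toMeasure) ∧
    IsNegDefKernel (fun μ ν : G.NodeMeasure =>
      G.regSobolevIPM z₀ G.lengthMeasure (ENNReal.ofReal p) μ.toMeasure ν.toMeasure ^ p) ∧
    ∀ t : ℝ, 0 < t →
      IsPosDefKernel (fun μ ν : G.NodeMeasure => Real.exp (-t *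
        G.regSobolevIPM z₀ G.lengthMeasure (ENNReal.ofReal p) μ.toMeasure ν.toMeasure)) ∧
      IsPosDefKernel (fun μ ν : G.NodeMeasure => Real.exp (-t *
        G.regSobolevIPM z₀ G.lengthMeasure (ENNReal.ofReal p) μ.toMeasure ν.toMeasure ^ p)) := by

  set k : G.NodeMeasure → G.NodeMeasure → ℝ := fun μ ν =>
    G.regSobolevIPM z₀ G.lengthMeasure (ENNReal.ofReal p) μ.toMeasure ν.toMeasure with hk
  have hp0 : 0 < p := one_pos.trans_le hp1
  have hval : ∀ μ ν, k μ ν = (∫ x, |μ.profile z₀ x - ν.profile z₀ x| ^ p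
      ∂G.lengthMeasure.withDensity (G.wHat z₀ G.lengthMeasure)) ^ (1 / p) := fun μ ν =>
    (hG.isGreatest_ipmValues hp1 μ ν).csSup_eq
  have hint0 : ∀ μ ν : G.NodeMeasure, 0 ≤ ∫ x, |μ.profile z₀ x - ν.profile z₀ x| ^ p
      ∂G.lengthMeasure.withDensity (G.wHat z₀ G.lengthMeasure) := fun μ ν =>
    integral_nonneg fun x => by positivity
  have hk0 : ∀ μ ν, 0 ≤ k μ ν := fun μ ν => by
    rw [hval]
    exact Real.rpow_nonneg (hint0 μ ν) _
  have hpow : IsNegDefKernel fun μ ν => k μ ν ^ p := by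
    have e : (fun μ ν => k μ ν ^ p) = fun μ ν : G.NodeMeasure =>
        ∫ x, |μ.profile z₀ x - ν.profile z₀ x| ^ p
          ∂G.lengthMeasure.withDensity (G.wHat z₀ G.lengthMeasure) := by
      ext μ ν
      rw [hval, ← Real.rpow_mul (hint0 μ ν), one_div_mul_cancel hp0.ne', Real.rpow_one]
    rw [e]
    refine isNegDefKernel_integral_abs_sub_rpow _ _ hp0 hp2 fun μ ν => ?_
    refine Integrable.of_bound
      ((((hG.measurable_profile μ).sub (hG.measurable_profile ν)).abs.pow_const
        _).aestronglyMeasurable)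
      ((∑ v : G.nodes, μ.toMeasure.real {G.node v} +
        ∑ v : G.nodes, ν.toMeasure.real {G.node v}) ^ p) (.of_forall fun x => ?_)
    rw [Real.norm_of_nonneg (by positivity)]
    exact Real.rpow_le_rpow (abs_nonneg _)
      ((abs_sub _ _).trans (add_le_add (μ.abs_profile_le x) (ν.abs_profile_le x))) hp0.le
  have hneg : IsNegDefKernel k := by
    have := hpow.rpow (fun μ ν => Real.rpow_nonneg (hk0 μ ν) p) (a := 1 / p) (by positivity)
      ((div_le_one hp0).2 hp1)
    convert this using 3 with μ ν
    rw [← Real.rpow_mul (hk0 μ ν), mul_one_div_cancel hp0.ne', Real.rpow_one]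
  exact ⟨fun μ ν => (hG.isGreatest_ipmValues hp1 μ ν).bddAbove, hneg, hpow, fun t ht =>
    ⟨hneg.isPosDefKernel_exp_neg_mul ht.le, hpow.isPosDefKernel_exp_neg_mul ht.le⟩⟩
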